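/- A \emph{contextuality scenario} is a pair $\mathbb G=(V,E)$, where $V$ is a finite set and $E$ is a non-empty set of subsets of $V$ with $\bigcup_{e\in E}e=V$. A \emph{probabilistic model} of $\mathbb G$ is a map $p:V\to[0,1]$ with $\sum_{x\in e}p(x)=1$ for all $e\in E$; $\mathcal G(\mathbb G)$ is the set of these, and $\mathbb G$ is \emph{non-trivial} if $\mathcal G(\mathbb G)\neq\emptyset$. A \emph{positive operator representation} (POR) of $\mathbb G$ on a Hilbert space $H$ is a family $(A_x)_{x\in V}$ of positive operators in $\mathcal B(H)$ with $\sum_{x\in e}A_x=I$ for all $e\in E$. \textbf{Models.} Let $\mathbb G=(V,E)$ and $\mathbb H=(W,F)$ be non-trivial contextuality scenarios, and let $\mathcal G(\mathbb G,\mathbb H)$ be the set of probabilistic models of the scenario $(V\times W,\{e\times f:e\in E,f\in F\})$. Such a model $p$ is \emph{no-signalling} if $\sum_{x\in e}p(x,y)$ does not depend on $e\in E$ and $\sum_{y\in f}p(x,y)$ does not depend on $f\in F$, for all $y\in W$, $x\in V$. Let $\tilde{\mathcal Q}_{\rm qc}(\mathbb G,\mathbb H)$ be the set of no-signalling models of the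 form $p(x,y)=\langle A_xB_y\xi,\xi\rangle$, where $(A_x)_{x\in V}$, $(B_y)_{y\in W}$ are PORs of $\mathbb G$, $\mathbb H$ on a common Hilbert space with $A_xB_y=B_yA_x$ for all $x,y$, and $\xi$ is a unit vector. Let $\tilde{\mathcal Q}_{\rm q}(\mathbb G,\mathbb H)$ be the set of no-signalling models of the form $p(x,y)=\langle (A_x\otimes B_y)\xi,\xi\rangle$, where $(A_x)$, $(B_y)$ are PORs of $\mathbb G$, $\mathbb H$ on finite dimensional Hilbert spaces $H_1$, $H_2$ and $\xi\in H_1\otimes H_2$ is a unit vector, and let $\tilde{\mathcal Q}_{\rm qa}(\mathbb G,\mathbb H)$ be its closure in $\mathbb R^{V\times W}$. \textbf{Operator systems.} Let $\mathcal S_{\mathbb G}$ be the operator system quotient of $\mathcal S=\bigoplus_{e\in E}\ell^\infty_e$ by $\tilde{\mathcal J}=\{u:\sum_{e\in E}\sum_{x\in e}p(x)u^e_x=0\text{ for all }p\in\mathcal G(\mathbb G)\}$; that is, a matrix over $\mathcal S/\tilde{\mathcal J}$ is positive if for every $\varepsilon>0$ it has a representative $u$ over $\mathcal S$ with $u+\varepsilon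 1\ge0$. Let $a_x$ be the image in $\mathcal S_{\mathbb G}$ of $|E|\,\delta^e_x$, where $\delta_x^e$ is the canonical basis vector of $\ell^\infty_e$; it does not depend on the choice of $e\in E$ with $x\in e$. Let $b_y\in\mathcal S_{\mathbb H}$, $y\in W$, be defined in the same way. The cones of the commuting tensor product $\mathcal S_{\mathbb G}\otimes_{\rm c}\mathcal S_{\mathbb H}$ consist of the matrices over the algebraic tensor product whose images under $\phi\cdot\psi$, $(\phi\cdot\psi)(a\otimes b)=\phi(a)\psi(b)$, are positive for all unital completely positive maps $\phi$, $\psi$ of $\mathcal S_{\mathbb G}$, $\mathcal S_{\mathbb H}$ into a common $\mathcal B(H)$ with commuting ranges; those of the minimal tensor product $\mathcal S_{\mathbb G}\otimes_{\min}\mathcal S_{\mathbb H}$ consist of the matrices whose images under $\phi\otimes\psi$ are positive for all unital completely positive $\phi:\mathcal S_{\mathbb G}\to M_k$, $\psi:\mathcal S_{\mathbb H}\to M_l$, $k,l\in\mathbb N$. A \emph{state} is a unital positive linear functional. \textbf{C*-algebras.} Let $(v_x)_{x\in V}$ be the direct sum of all families $(U_x)_{x\in V}$ of bounded operators $U_x:H\to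 H'$ between Hilbert spaces of dimension at most the continuum (up to unitary equivalence) with $\sum_{x\in e}U_x^*U_x=I_H$ for all $e\in E$. Put $g_{x,x'}=v_x^*v_{x'}$ and let $\mathcal B_{\mathbb G}$ be the C*-algebra generated by $\{g_{x,x}:x\in V\}$; define $\mathcal B_{\mathbb H}$ in the same way, with generators $h_{y,y}$, $y\in W$. Let $\otimes_{\max}$ and $\otimes_{\min}$ also denote the maximal and the minimal (spatial) tensor product of C*-algebras. For a functional $s$ on $\mathcal S_{\mathbb G}\otimes\mathcal S_{\mathbb H}$ write $p^s(x,y)=s(a_x\otimes b_y)$, and for a functional $s$ on $\mathcal B_{\mathbb G}\otimes_{\max}\mathcal B_{\mathbb H}$ or $\mathcal B_{\mathbb G}\otimes_{\min}\mathcal B_{\mathbb H}$ write $p^s(x,y)=s(g_{x,x}\otimes h_{y,y})$, $x\in V$, $y\in W$. \textbf{Theorem.} Let $\mathbb G$, $\mathbb H$ be non-trivial contextuality scenarios and $p\in\mathcal G(\mathbb G,\mathbb H)$. The following are equivalent: \begin{enumerate} \item $p\in\tilde{\mathcal Q}_{\rm qc}(\mathbb G,\mathbb H)$ (resp. $p\in\tilde{\mathcal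 Q}_{\rm qa}(\mathbb G,\mathbb H)$); \item there is a state $s$ on $\mathcal S_{\mathbb G}\otimes_{\rm c}\mathcal S_{\mathbb H}$ (resp. $\mathcal S_{\mathbb G}\otimes_{\min}\mathcal S_{\mathbb H}$) with $p=p^s$; \item there is a state $s$ on $\mathcal B_{\mathbb G}\otimes_{\max}\mathcal B_{\mathbb H}$ (resp. $\mathcal B_{\mathbb G}\otimes_{\min}\mathcal B_{\mathbb H}$) with $p=p^s$. \end{enumerate} Moreover, $s\mapsto p^s$ is an affine isomorphism from the state space of $\mathcal S_{\mathbb G}\otimes_{\rm c}\mathcal S_{\mathbb H}$ (resp. $\mathcal S_{\mathbb G}\otimes_{\min}\mathcal S_{\mathbb H}$) onto $\tilde{\mathcal Q}_{\rm qc}(\mathbb G,\mathbb H)$ (resp. $\tilde{\mathcal Q}_{\rm qa}(\mathbb G,\mathbb H)$). -/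

import Mathlib

open scoped TensorProduct ComplexOrder ENNReal

noncomputable section

namespace Contextuality

/-! ### Contextuality scenarios and probabilistic models -/

/-- A contextuality scenario: a hypergraph on a (finite) vertex set `V` with a non-empty set of
hyperedges that covers `V`. -/
structure Scenario (V : Type) where
  edges : Finset (Finset V)
  nonempty : edges.Nonempty
  covers : ∀ x : V, ∃ e ∈ edges, x ∈ e

variable {V W : Type}

/-- The set of probabilistic models of a scenario. -/
def Scenario.models (G : Scenario V) : Set (V → ℝ) :=
  {p | (∀ x, p x ∈ Set.Icc (0 : ℝ) 1) ∧ ∀ e ∈ G.edges, ∑ x ∈ e, p x = 1}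

/-- A scenario is non-trivial if it admits a probabilistic model. -/
def Scenario.IsNontrivial (G : Scenario V) : Prop := G.models.Nonempty

/-- The product scenario, on the vertex set `V × W`, with hyperedges `e × f`. -/
def Scenario.prod (G : Scenario V) (K : Scenario W) : Scenario (V × W) := by
  classical
  exact
    { edges := Finset.image₂ (fun e f => e ×ˢ f) G.edges K.edges
      nonempty := G.nonempty.image₂ K.nonempty
      covers := by
        rintro ⟨x, y⟩
        obtain ⟨e, he, hx⟩ := G.covers x
        obtain ⟨f, hf, hy⟩ := K.covers y
        exact ⟨e ×ˢ f, Finset.mem_image₂_of_mem he hf, Finset.mk_mem_product hx hy⟩ }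

/-- The no-signalling probabilistic models of the product scenario. -/
def noSignalling (G : Scenario V) (K : Scenario W) : Set (V × W → ℝ) :=
  {p | p ∈ (G.prod K).models ∧
    (∀ y, ∀ e ∈ G.edges, ∀ e' ∈ G.edges, ∑ x ∈ e, p (x, y) = ∑ x ∈ e', p (x, y)) ∧
    (∀ x, ∀ f ∈ K.edges, ∀ f' ∈ K.edges, ∑ y ∈ f, p (x, y) = ∑ y ∈ f', p (x, y))}

/-- A positive operator representation (POR) of the scenario `G` on the Hilbert space `H`. -/
def IsPOR {H : Type} [NormedAddCommGroup H] [InnerProductSpace ℂ H]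
    (G : Scenario V) (A : V → H →L[ℂ] H) : Prop :=
  (∀ x, (A x).IsPositive) ∧ ∀ e ∈ G.edges, ∑ x ∈ e, A x = 1

/-- The generalised commuting probabilistic models `Q̃_qc(G, K)`. -/
def genQC (G : Scenario V) (K : Scenario W) : Set (V × W → ℝ) :=
  {p | p ∈ noSignalling G K ∧
    ∃ (H : Type) (_ : NormedAddCommGroup H) (_ : InnerProductSpace ℂ H) (_ : CompleteSpace H)
      (A : V → H →L[ℂ] H) (B : W → H →L[ℂ] H) (ξ : H),
      IsPOR G A ∧ IsPOR K B ∧ (∀ x y, A x * B y = B y * A x) ∧ ‖ξ‖ = 1 ∧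
      ∀ x y, (p (x, y) : ℂ) = inner ℂ ξ ((A x * B y) ξ)}

/-- The generalised tensor probabilistic models `Q̃_q(G, K)` over finite dimensional Hilbert
spaces. (The algebraic tensor product of finite dimensional Hilbert spaces is complete.) -/
def genQ (G : Scenario V) (K : Scenario W) : Set (V × W → ℝ) :=
  {p | p ∈ noSignalling G K ∧
    ∃ (H₁ : Type) (_ : NormedAddCommGroup H₁) (_ : InnerProductSpace ℂ H₁)
      (H₂ : Type) (_ : NormedAddCommGroup H₂) (_ : InnerProductSpace ℂ H₂)
      (A : V → H₁ →L[ℂ] H₁) (B : W → H₂ →L[ℂ] H₂) (ξ : H₁ ⊗[ℂ] H₂),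
      FiniteDimensional ℂ H₁ ∧ FiniteDimensional ℂ H₂ ∧
      IsPOR G A ∧ IsPOR K B ∧ ‖ξ‖ = 1 ∧
      ∀ x y, (p (x, y) : ℂ) =
        inner ℂ ξ ((TensorProduct.mapL (A x) (1 : H₂ →L[ℂ] H₂) *
          TensorProduct.mapL (1 : H₁ →L[ℂ] H₁) (B y)) ξ)}

/-- The generalised approximately quantum models `Q̃_qa(G, K)`: the closure of `Q̃_q(G, K)`. -/
def genQA (G : Scenario V) (K : Scenario W) : Set (V × W → ℝ) := closure (genQ G K)

/-! ### Matrix orders, completely positive maps, states, quotients and tensor products -/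

/-- The order data of an operator system: the unit and the cones `M_n(S)⁺`. The elements of the
cones are hermitian in every operator system, so that the involution is not recorded; it plays no
role for positive functionals and completely positive maps. -/
structure MatrixOrder (S : Type) [AddCommGroup S] [Module ℂ S] where
  one : S
  cone : ∀ n : ℕ, Set (Matrix (Fin n) (Fin n) S)

section OperatorSystems

variable {S T : Type} [AddCommGroup S] [Module ℂ S] [AddCommGroup T] [Module ℂ T]

/-- The states: the unital linear functionals that are positive on `S⁺ = M_1(S)⁺`. -/
def MatrixOrder.states (O : MatrixOrder S) : Set (S →ₗ[ℂ] ℂ) :=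
  {s | s O.one = 1 ∧ ∀ a : S, (Matrix.of fun _ _ : Fin 1 => a) ∈ O.cone 1 → 0 ≤ s a}

/-- Positivity of a matrix `[T i j]` of bounded operators on `H`, as an operator on `Hⁿ`. -/
def IsPositiveOpMatrix {H : Type} [NormedAddCommGroup H] [InnerProductSpace ℂ H] {n : ℕ}
    (M : Matrix (Fin n) (Fin n) (H →L[ℂ] H)) : Prop :=
  ∀ ξ : Fin n → H, 0 ≤ ∑ i, ∑ j, inner ℂ (ξ i) (M i j (ξ j))

/-- Unital completely positive maps from an operator system into `B(H)`. -/
def MatrixOrder.IsUCP {H : Type} [NormedAddCommGroup H] [InnerProductSpace ℂ H]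
    (O : MatrixOrder S) (φ : S →ₗ[ℂ] H →L[ℂ] H) : Prop :=
  φ O.one = 1 ∧ ∀ n, ∀ M ∈ O.cone n, IsPositiveOpMatrix (M.map φ)

/-- The operator system quotient `S/J`: a matrix is positive if, for every `ε > 0`, it has a
representative `u` over `S` with `u + ε 1` positive. -/
def MatrixOrder.quotient (O : MatrixOrder S) (J : Submodule ℂ S) : MatrixOrder (S ⧸ J) where
  one := J.mkQ O.one
  cone n := {M | ∀ ε : ℝ, 0 < ε → ∃ u : Matrix (Fin n) (Fin n) S,
    u.map J.mkQ = M ∧ (u + Matrix.diagonal fun _ => (ε : ℂ) • O.one) ∈ O.cone n}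

/-- The map `φ · ψ : S ⊗ T → B(H)`, `a ⊗ b ↦ φ(a) ψ(b)`. -/
def opProd {H : Type} [NormedAddCommGroup H] [InnerProductSpace ℂ H]
    (φ : S →ₗ[ℂ] H →L[ℂ] H) (ψ : T →ₗ[ℂ] H →L[ℂ] H) : S ⊗[ℂ] T →ₗ[ℂ] H →L[ℂ] H :=
  LinearMap.mul' ℂ (H →L[ℂ] H) ∘ₗ TensorProduct.map φ ψ

/-- The map `φ ⊗ ψ : S ⊗ T → B(H₁ ⊗ H₂)`, `a ⊗ b ↦ φ(a) ⊗ ψ(b)`. -/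
def opTensor {H₁ H₂ : Type} [NormedAddCommGroup H₁] [InnerProductSpace ℂ H₁]
    [NormedAddCommGroup H₂] [InnerProductSpace ℂ H₂]
    (φ : S →ₗ[ℂ] H₁ →L[ℂ] H₁) (ψ : T →ₗ[ℂ] H₂ →L[ℂ] H₂) :
    S ⊗[ℂ] T →ₗ[ℂ] (H₁ ⊗[ℂ] H₂ →L[ℂ] H₁ ⊗[ℂ] H₂) :=
  TensorProduct.lift (LinearMap.mk₂ ℂ (fun a b => TensorProduct.mapL (φ a) (ψ b))
    (fun _ _ _ => by rw [map_add, TensorProduct.mapL_add_left])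
    (fun _ _ _ => by rw [map_smul, TensorProduct.mapL_smul_left])
    (fun _ _ _ => by rw [map_add, TensorProduct.mapL_add_right])
    (fun _ _ _ => by rw [map_smul, TensorProduct.mapL_smul_right]))

/-- The commuting tensor product `S ⊗_c T`: a matrix over `S ⊗ T` is positive if its image under
`φ · ψ` is positive for all unital completely positive maps `φ`, `ψ` into a common `B(H)` with
commuting ranges. -/
def MatrixOrder.commTensor (O : MatrixOrder S) (P : MatrixOrder T) : MatrixOrder (S ⊗[ℂ] T) where
  one := O.one ⊗ₜ P.one
  cone _ := {M | ∀ (H : Type) [NormedAddCommGroup H] [InnerProductSpace ℂ H] [CompleteSpace H]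
    (φ : S →ₗ[ℂ] H →L[ℂ] H) (ψ : T →ₗ[ℂ] H →L[ℂ] H), O.IsUCP φ → P.IsUCP ψ →
    (∀ a b, φ a * ψ b = ψ b * φ a) → IsPositiveOpMatrix (M.map (opProd φ ψ))}

/-- The minimal tensor product `S ⊗_min T`: a matrix over `S ⊗ T` is positive if its image under
`φ ⊗ ψ` is positive for all unital completely positive `φ : S → M_k`, `ψ : T → M_l`. -/
def MatrixOrder.minTensor (O : MatrixOrder S) (P : MatrixOrder T) : MatrixOrder (S ⊗[ℂ] T) where
  one := O.one ⊗ₜ P.one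
  cone _ := {M | ∀ (k l : ℕ)
    (φ : S →ₗ[ℂ] EuclideanSpace ℂ (Fin k) →L[ℂ] EuclideanSpace ℂ (Fin k))
    (ψ : T →ₗ[ℂ] EuclideanSpace ℂ (Fin l) →L[ℂ] EuclideanSpace ℂ (Fin l)),
    O.IsUCP φ → P.IsUCP ψ → IsPositiveOpMatrix (M.map (opTensor φ ψ))}

end OperatorSystems

/-! ### The universal operator system `S_G` -/

/-- The underlying vector space of `⊕_{e ∈ E} ℓ^∞_e`. -/
abbrev Scenario.LInfSum (G : Scenario V) : Type := (e : G.edges) → (e.1 → ℂ)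

/-- The operator system `⊕_{e ∈ E} ℓ^∞_e`, with `M_n(⊕_e ℓ^∞_e) = ⊕_e ⊕_{x ∈ e} M_n`. -/
def Scenario.lInfOrder (G : Scenario V) : MatrixOrder G.LInfSum where
  one := 1
  cone _ := {u | ∀ (e : G.edges) (x : e.1), (u.map fun v => v e x).PosSemidef}

/-- The kernel `J̃ = {u : ⟨p, u⟩ = 0 for every probabilistic model p}`. -/
def Scenario.kernel (G : Scenario V) : Submodule ℂ G.LInfSum where
  carrier := {u | ∀ p ∈ G.models, ∑ e : G.edges, ∑ x : e.1, (p x : ℂ) * u e x = 0}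
  zero_mem' := by intro p _; simp
  add_mem' := by
    intro u v hu hv p hp
    simp only [Pi.add_apply, mul_add, Finset.sum_add_distrib]
    rw [hu p hp, hv p hp, add_zero]
  smul_mem' := by
    intro c u hu p hp
    simp only [Pi.smul_apply, smul_eq_mul, mul_left_comm _ c]
    simp only [← Finset.mul_sum]
    rw [hu p hp, mul_zero]

/-- The vector space underlying `S_G = (⊕_e ℓ^∞_e) / J̃`. -/
abbrev Scenario.SG (G : Scenario V) : Type := G.LInfSum ⧸ G.kernel

/-- The universal operator system `S_G`. -/
def Scenario.sgOrder (G : Scenario V) : MatrixOrder G.SG := G.lInfOrder.quotient G.kernel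

/-- The element `|E| q(δ_x^e)` of `S_G`, for `x ∈ e ∈ E`. -/
def Scenario.genOf (G : Scenario V) (e : G.edges) (x : e.1) : G.SG := by
  classical
  exact (G.edges.card : ℂ) • G.kernel.mkQ (Pi.single e (Pi.single x 1))

/-- The element `|E| q(δ_x^e)` depends on `x` only. -/
theorem Scenario.genOf_eq (G : Scenario V) (e f : G.edges) (x : V) (he : x ∈ e.1)
    (hf : x ∈ f.1) : G.genOf e ⟨x, he⟩ = G.genOf f ⟨x, hf⟩ := by
  classical
  have key : ∀ (e : G.edges) (he : x ∈ e.1) (p : V → ℝ),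
      ∑ e' : G.edges, ∑ y : e'.1, (p y : ℂ) *
        (Pi.single e (Pi.single ⟨x, he⟩ 1) : G.LInfSum) e' y = p x := by
    intro e he p
    rw [Finset.sum_eq_single e]
    · simp [Pi.single_apply]
    · intro e' _ hne
      simp [Pi.single_eq_of_ne hne]
    · simp
  unfold Scenario.genOf
  congr 1
  refine (Submodule.Quotient.eq _).2 ?_
  intro p hp
  simp only [Pi.sub_apply, mul_sub, Finset.sum_sub_distrib]
  rw [key e he p, key f hf p, sub_self]

/-- The canonical generators `a_x` of `S_G`. -/
def Scenario.gen (G : Scenario V) (x : V) : G.SG :=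
  G.genOf ⟨(G.covers x).choose, (G.covers x).choose_spec.1⟩ ⟨x, (G.covers x).choose_spec.2⟩

/-- For a functional `s` on `S_G ⊗ S_K`, the function `p^s(x, y) = s(a_x ⊗ b_y)`. -/
def pState (G : Scenario V) (K : Scenario W) (s : G.SG ⊗[ℂ] K.SG →ₗ[ℂ] ℂ) : V × W → ℂ :=
  fun z => s (G.gen z.1 ⊗ₜ K.gen z.2)

/-! ### Direct sums of C*-algebras of operators, and the C*-algebra `B_G` -/

/-- The bounded diagonal operators on the direct sum of the Hilbert spaces `H i`, as the
C*-algebra `ℓ^∞-⊕ B(H i)`. -/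
def DiagOp {I : Type*} (H : I → Type*) [∀ i, NormedAddCommGroup (H i)]
    [∀ i, InnerProductSpace ℂ (H i)] : Type _ := lp (fun i => H i →L[ℂ] H i) ∞

section DiagOp

variable {I : Type*} (H : I → Type*) [∀ i, NormedAddCommGroup (H i)]
  [∀ i, InnerProductSpace ℂ (H i)]

instance [∀ i, CompleteSpace (H i)] [∀ i, Nontrivial (H i)] : CStarAlgebra (DiagOp H) :=
  { (inferInstance : NormedRing (lp (fun i => H i →L[ℂ] H i) ∞)),
    (inferInstance : StarRing (lp (fun i => H i →L[ℂ] H i) ∞)),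
    (inferInstance : CompleteSpace (lp (fun i => H i →L[ℂ] H i) ∞)),
    (inferInstance : CStarRing (lp (fun i => H i →L[ℂ] H i) ∞)),
    (inferInstance : NormedAlgebra ℂ (lp (fun i => H i →L[ℂ] H i) ∞)),
    (inferInstance : StarModule ℂ (lp (fun i => H i →L[ℂ] H i) ∞)) with }

variable {H}

/-- The direct sum of a bounded family of operators. -/
def DiagOp.mk (T : ∀ i, H i →L[ℂ] H i) (c : ℝ) (hT : ∀ i, ‖T i‖ ≤ c) : DiagOp H :=
  (⟨T, memℓp_infty ⟨c, by rintro _ ⟨i, rfl⟩; exact hT i⟩⟩ : lp (fun i => H i →L[ℂ] H i) ∞)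

/-- The `i`-th component of a diagonal operator. -/
def DiagOp.apply (T : DiagOp H) (i : I) : H i →L[ℂ] H i :=
  (show lp (fun i => H i →L[ℂ] H i) ∞ from T) i

theorem DiagOp.ext {S T : DiagOp H} (h : ∀ i, S.apply i = T.apply i) : S = T :=
  lp.ext (E := fun i => H i →L[ℂ] H i) (p := ∞) (funext h)

end DiagOp

/-- The unital C*-subalgebra of `A` generated by a set. -/
def cstarGen {A : Type*} [CStarAlgebra A] (X : Set A) : StarSubalgebra ℂ A :=
  (StarAlgebra.adjoin ℂ X).topologicalClosure

instance {A : Type*} [CStarAlgebra A] (X : Set A) : IsClosed (cstarGen X : Set A) :=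
  StarSubalgebra.isClosed_topologicalClosure _

instance {A : Type*} [CStarAlgebra A] (X : Set A) : CStarAlgebra (cstarGen X) :=
  StarSubalgebra.cstarAlgebra (cstarGen X)

theorem subset_cstarGen {A : Type*} [CStarAlgebra A] (X : Set A) : X ⊆ cstarGen X := fun _ h =>
  StarSubalgebra.le_topologicalClosure _ (StarAlgebra.subset_adjoin ℂ X h)

/-- The Hilbert space `ℓ²(D)`, for a set `D` of real numbers. -/
def L2 (D : Set ℝ) : Type := lp (fun _ : D => ℂ) 2

instance (D : Set ℝ) : NormedAddCommGroup (L2 D) :=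
  inferInstanceAs (NormedAddCommGroup (lp (fun _ : D => ℂ) 2))

instance (D : Set ℝ) : InnerProductSpace ℂ (L2 D) :=
  inferInstanceAs (InnerProductSpace ℂ (lp (fun _ : D => ℂ) 2))

instance (D : Set ℝ) : CompleteSpace (L2 D) :=
  inferInstanceAs (CompleteSpace (lp (fun _ : D => ℂ) 2))

/-- A family `(U_x)` of operators `ℓ²(dom) → ℓ²(cod)` with `∑_{x ∈ e} U_x* U_x = 1` for every
hyperedge `e`, that is, a non-degenerate representation of the universal ternary ring of `G`. This
ring has the cardinality of the continuum, and every Hilbert space whose dimension is at most that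
is `ℓ²(D)` for a subset `D` of `ℝ`, up to unitary equivalence. -/
structure Scenario.TernaryRep (G : Scenario V) where
  dom : Set ℝ
  cod : Set ℝ
  dom_nonempty : dom.Nonempty
  U : V → L2 dom →L[ℂ] L2 cod
  sum_eq : ∀ e ∈ G.edges, ∑ x ∈ e, (ContinuousLinearMap.adjoint (U x)) ∘L (U x) = 1

/-- The space on which the right C*-algebra of the representation acts. -/
abbrev Scenario.TernaryRep.space {G : Scenario V} (θ : G.TernaryRep) : Type := L2 θ.dom

instance {G : Scenario V} (θ : G.TernaryRep) : Nontrivial θ.space := by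
  obtain ⟨t, ht⟩ := θ.dom_nonempty
  classical
  refine ⟨⟨(lp.single 2 (⟨t, ht⟩ : θ.dom) (1 : ℂ) : lp (fun _ : θ.dom => ℂ) 2), 0, fun h => ?_⟩⟩
  have := congrArg (fun f : lp (fun _ : θ.dom => ℂ) 2 => f ⟨t, ht⟩) h
  simp at this
  exact one_ne_zero this

theorem Scenario.TernaryRep.norm_le {G : Scenario V} (θ : G.TernaryRep) (x : V) :
    ‖θ.U x‖ ≤ 1 := by
  obtain ⟨e, he, hx⟩ := G.covers x
  refine ContinuousLinearMap.opNorm_le_bound _ zero_le_one fun ξ => ?_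
  have h1 : ∑ y ∈ e, ‖θ.U y ξ‖ ^ 2 = ‖ξ‖ ^ 2 := by
    have h := congrArg (fun T : θ.space →L[ℂ] θ.space => RCLike.re (inner ℂ (T ξ) ξ))
      (θ.sum_eq e he)
    simp only [sum_apply, ContinuousLinearMap.comp_apply, sum_inner,
      ContinuousLinearMap.adjoint_inner_left, one_apply_eq_self, map_sum,
      inner_self_eq_norm_sq] at h
    exact h
  have h2 : ‖θ.U x ξ‖ ^ 2 ≤ ‖ξ‖ ^ 2 := by
    rw [← h1]
    exact Finset.single_le_sum (f := fun y => ‖θ.U y ξ‖ ^ 2) (fun _ _ => sq_nonneg _) hx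
  rw [one_mul]
  exact (sq_le_sq₀ (norm_nonneg _) (norm_nonneg _)).1 h2

/-- The element `g_{x,x'} = v_x* v_{x'}`, where `v_x = ⊕_θ θ(v_x)` is the canonical generator of the
universal ternary ring of operators of `G`, realised by the direct sum of all representations. -/
def Scenario.g (G : Scenario V) (x x' : V) : DiagOp (fun θ : G.TernaryRep => θ.space) :=
  DiagOp.mk (fun θ => (ContinuousLinearMap.adjoint (θ.U x)) ∘L (θ.U x')) 1 fun θ => by
    refine (ContinuousLinearMap.opNorm_comp_le _ _).trans ?_
    rw [LinearIsometryEquiv.norm_map]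
    exact mul_le_one₀ (θ.norm_le x) (norm_nonneg _) (θ.norm_le x')

/-- The C*-algebra `B_G`, generated by the elements `g_{x,x}`, `x ∈ V`, inside the right C*-algebra
of the universal ternary ring of operators (the closed span of the products `S* T`), which is itself
a subalgebra of the ambient algebra of diagonal operators. -/
abbrev Scenario.BG (G : Scenario V) :
    StarSubalgebra ℂ (DiagOp (fun θ : G.TernaryRep => θ.space)) :=
  cstarGen (Set.range fun x => G.g x x)

/-- The generator `g_{x,x}` as an element of `B_G`. -/
def Scenario.bgen (G : Scenario V) (x : V) : G.BG :=
  ⟨G.g x x, subset_cstarGen _ (Set.mem_range_self x)⟩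

/-! ### Tensor products of C*-algebras -/

/-- The states of a unital C*-algebra. -/
def cstarStates (A : Type*) [CStarAlgebra A] : Set (A →ₗ[ℂ] ℂ) :=
  {f | f 1 = 1 ∧ ∀ a, 0 ≤ f (star a * a)}

/-- A pair of unital *-representations of `A` and `B` on a common Hilbert space with commuting
ranges. -/
structure CommRep (A B : Type) [CStarAlgebra A] [CStarAlgebra B] where
  H : Type
  [instNACG : NormedAddCommGroup H]
  [instIPS : InnerProductSpace ℂ H]
  [instComplete : CompleteSpace H]
  [instNontrivial : Nontrivial H]
  π : A →⋆ₐ[ℂ] (H →L[ℂ] H)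
  ρ : B →⋆ₐ[ℂ] (H →L[ℂ] H)
  comm : ∀ a b, π a * ρ b = ρ b * π a

attribute [instance] CommRep.instNACG CommRep.instIPS CommRep.instComplete CommRep.instNontrivial

section CStarTensor

variable {A B : Type} [CStarAlgebra A] [CStarAlgebra B]

/-- The pair is, up to unitary equivalence, of the form `a ↦ π₀(a) ⊗ 1`, `b ↦ 1 ⊗ ρ₀(b)` on the
Hilbert space tensor product `H₁ ⊗ H₂` (the completion of the algebraic tensor product). -/
def CommRep.IsSpatial (P : CommRep A B) : Prop :=
  ∃ (H₁ : Type) (_ : NormedAddCommGroup H₁) (_ : InnerProductSpace ℂ H₁) (_ : CompleteSpace H₁)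
    (H₂ : Type) (_ : NormedAddCommGroup H₂) (_ : InnerProductSpace ℂ H₂) (_ : CompleteSpace H₂)
    (π₀ : A →⋆ₐ[ℂ] (H₁ →L[ℂ] H₁)) (ρ₀ : B →⋆ₐ[ℂ] (H₂ →L[ℂ] H₂))
    (J : H₁ ⊗[ℂ] H₂ →ₗᵢ[ℂ] P.H),
    DenseRange J ∧
    (∀ a ξ η, P.π a (J (ξ ⊗ₜ η)) = J (π₀ a ξ ⊗ₜ η)) ∧
    (∀ b ξ η, P.ρ b (J (ξ ⊗ₜ η)) = J (ξ ⊗ₜ ρ₀ b η))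

/-- The direct sum of a family of representations. -/
def diagHom {C : Type} [CStarAlgebra C] {I : Type*} (H : I → Type*)
    [∀ i, NormedAddCommGroup (H i)] [∀ i, InnerProductSpace ℂ (H i)] [∀ i, CompleteSpace (H i)]
    [∀ i, Nontrivial (H i)] (σ : ∀ i, C →⋆ₐ[ℂ] (H i →L[ℂ] H i)) : C →⋆ₐ[ℂ] DiagOp H where
  toFun c := DiagOp.mk (fun i => σ i c) ‖c‖ fun i => NonUnitalStarAlgHom.norm_apply_le (σ i) c
  map_one' := DiagOp.ext fun i => map_one (σ i)
  map_mul' a b := DiagOp.ext fun i => map_mul (σ i) a b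
  map_zero' := DiagOp.ext fun i => map_zero (σ i)
  map_add' a b := DiagOp.ext fun i => map_add (σ i) a b
  commutes' r := DiagOp.ext fun i => AlgHomClass.commutes (σ i) r
  map_star' a := DiagOp.ext fun i => map_star (σ i) a

/-- The completion of `A ⊗ B` in the norm `sup ‖∑ π(a_k) ρ(b_k)‖` over the pairs `(π, ρ)` that
satisfy `𝓕`, realised as the C*-algebra generated by the images of `A` and `B` under the direct sum
of these pairs (the images commute, so that this is the closure of the image of `A ⊗ B`). -/
abbrev tensorCompletion (A B : Type) [CStarAlgebra A] [CStarAlgebra B] (𝓕 : CommRep A B → Prop) :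
    StarSubalgebra ℂ (DiagOp (fun P : {P : CommRep A B // 𝓕 P} => P.1.H)) :=
  cstarGen (Set.range (diagHom (fun P : {P : CommRep A B // 𝓕 P} => P.1.H) fun P => P.1.π) ∪
    Set.range (diagHom (fun P : {P : CommRep A B // 𝓕 P} => P.1.H) fun P => P.1.ρ))

/-- The image of the elementary tensor `a ⊗ b`. -/
def tensorCompletion.tmul (𝓕 : CommRep A B → Prop) (a : A) (b : B) : tensorCompletion A B 𝓕 :=
  ⟨diagHom (fun P : {P : CommRep A B // 𝓕 P} => P.1.H) (fun P => P.1.π) a,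
    subset_cstarGen _ (Or.inl ⟨a, rfl⟩)⟩ *
  ⟨diagHom (fun P : {P : CommRep A B // 𝓕 P} => P.1.H) (fun P => P.1.ρ) b,
    subset_cstarGen _ (Or.inr ⟨b, rfl⟩)⟩

end CStarTensor

/-- The maximal tensor product of C*-algebras. -/
abbrev MaxTensor (A B : Type) [CStarAlgebra A] [CStarAlgebra B] :
    StarSubalgebra ℂ (DiagOp (fun P : {_P : CommRep A B // True} => P.1.H)) :=
  tensorCompletion A B fun _ => True

/-- The minimal (spatial) tensor product of C*-algebras. -/
abbrev MinTensor (A B : Type) [CStarAlgebra A] [CStarAlgebra B] :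
    StarSubalgebra ℂ (DiagOp (fun P : {P : CommRep A B // P.IsSpatial} => P.1.H)) :=
  tensorCompletion A B CommRep.IsSpatial

/-- For a functional `s` on a completion of `B_G ⊗ B_K`, the function
`p^s(x, y) = s(g_{x,x} ⊗ g_{y,y})`. -/
def pStateB (G : Scenario V) (K : Scenario W) {𝓕 : CommRep G.BG K.BG → Prop}
    (s : tensorCompletion G.BG K.BG 𝓕 →ₗ[ℂ] ℂ) : V × W → ℂ :=
  fun z => s (tensorCompletion.tmul 𝓕 (G.bgen z.1) (K.bgen z.2))

/-! ### Affine isomorphisms -/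

/-- A real-valued function, regarded as a complex-valued one. -/
def toComplex (p : V × W → ℝ) : V × W → ℂ := fun z => (p z : ℂ)

/-- `Φ` restricts to an affine isomorphism between the convex sets `C` and `D`. -/
def IsAffineIso {X Y : Type*} [AddCommGroup X] [Module ℝ X] [AddCommGroup Y] [Module ℝ Y]
    (Φ : X → Y) (C : Set X) (D : Set Y) : Prop :=
  Convex ℝ C ∧ Convex ℝ D ∧ Set.BijOn Φ C D ∧
    ∀ s ∈ C, ∀ t ∈ C, ∀ r ∈ Set.Icc (0 : ℝ) 1,
      Φ (r • s + (1 - r) • t) = r • Φ s + (1 - r) • Φ t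

end Contextuality

end

/-!
Unital completely positive maps `S_G → B(H)` are the same as PORs of `G` on `H`, via `a_x ↦ A_x`,
and the elements `a_x ⊗ b_y` span `S_G ⊗ S_K`, so that a state is determined by its model.

(1) ⇒ (3): a commuting model lives on the separable space generated by its vector. There
`A_x = R_x* R_x`, so that the family `(R_x)` is a component of the universal family `(v_x)`;
projecting onto it represents `B_G` with `g_{x,x} ↦ A_x`, and a vector state gives the model. In the
minimal case this applies to the finite dimensional models, and the closure is absorbed by the weak*
compactness of the state space.

(3) ⇒ (2): restrict the state along the completely positive maps `a_x ↦ g_{x,x}`, `b_y ↦ h_{y,y}`.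

(2) ⇒ (1): both sets of models are closed and convex. For commuting models, the direct sum of
realisations of all of them generates a single C*-algebra whose states produce exactly these models;
for tensor product models, convexity comes from direct sums. If the values of a state were outside
the set, a separating functional would be an element of the positive cone on which the state is
negative.
-/

noncomputable section

namespace Contextuality

/-! ### States of C*-algebras -/

section States

universe u

variable {A : Type u} [CStarAlgebra A]

/-- The vector functional `T ↦ ⟨T ξ, ξ⟩` on the bounded operators. -/
def vectorFunctional {H : Type*} [NormedAddCommGroup H] [InnerProductSpace ℂ H] (ξ : H) :
    (H →L[ℂ] H) →ₗ[ℂ] ℂ where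
  toFun T := inner ℂ ξ (T ξ)
  map_add' S T := by rw [add_apply, inner_add_right]
  map_smul' c T := by rw [smul_apply, inner_smul_right, RingHom.id_apply, smul_eq_mul]

/-- The vector functional `a ↦ ⟨π(a) ξ, ξ⟩` of a representation `π`. -/
def vectorState {H : Type*} [NormedAddCommGroup H] [InnerProductSpace ℂ H] [CompleteSpace H]
    (π : A →⋆ₐ[ℂ] (H →L[ℂ] H)) (ξ : H) : A →ₗ[ℂ] ℂ :=
  vectorFunctional ξ ∘ₗ π.toAlgHom.toLinearMap

theorem vectorState_apply {H : Type*} [NormedAddCommGroup H] [InnerProductSpace ℂ H]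
    [CompleteSpace H] (π : A →⋆ₐ[ℂ] (H →L[ℂ] H)) (ξ : H) (a : A) :
    vectorState π ξ a = inner ℂ ξ (π a ξ) := rfl

theorem vectorState_mem_cstarStates {H : Type*} [NormedAddCommGroup H] [InnerProductSpace ℂ H]
    [CompleteSpace H] (π : A →⋆ₐ[ℂ] (H →L[ℂ] H)) {ξ : H} (hξ : ‖ξ‖ = 1) :
    vectorState π ξ ∈ cstarStates A := by
  refine ⟨?_, fun a => ?_⟩
  · simp [vectorState_apply, hξ]
  · rw [vectorState_apply, map_mul, map_star, mul_apply_eq_comp,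
      ContinuousLinearMap.star_eq_adjoint, ContinuousLinearMap.adjoint_inner_right,
      inner_self_eq_norm_sq_to_K]
    positivity

theorem exists_eq_vectorState {s : A →ₗ[ℂ] ℂ} (hs : s ∈ cstarStates A) :
    ∃ (H : Type u) (_ : NormedAddCommGroup H) (_ : InnerProductSpace ℂ H) (_ : CompleteSpace H)
      (π : A →⋆ₐ[ℂ] (H →L[ℂ] H)) (ξ : H), ‖ξ‖ = 1 ∧ s = vectorState π ξ := by
  let _ : PartialOrder A := CStarAlgebra.spectralOrder A
  have _ : StarOrderedRing A := CStarAlgebra.spectralOrderedRing A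
  let f : A →ₚ[ℂ] ℂ := PositiveLinearMap.mk₀ s fun a ha => by
    obtain ⟨c, rfl⟩ := CStarAlgebra.nonneg_iff_eq_star_mul_self.1 ha
    exact hs.2 c
  let ξ : f.GNS := (f.toPreGNS 1 : f.PreGNS)
  have hs_eq : s = vectorState f.gnsStarAlgHom ξ := by
    ext a
    change s a = inner ℂ ξ (f.gnsNonUnitalStarAlgHom a ξ)
    rw [PositiveLinearMap.gnsNonUnitalStarAlgHom_apply_coe, UniformSpace.Completion.inner_coe,
      PositiveLinearMap.preGNS_inner_def]
    simp only [PositiveLinearMap.ofPreGNS_toPreGNS, PositiveLinearMap.leftMulMapPreGNS_apply,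
      star_one, one_mul, mul_one]
    rfl
  have hξ : inner ℂ ξ ξ = 1 := by
    rw [← hs.1, hs_eq, vectorState_apply, map_one, one_apply_eq_self]
  exact ⟨f.GNS, inferInstance, inferInstance, inferInstance, f.gnsStarAlgHom, ξ,
    by rw [@norm_eq_sqrt_re_inner ℂ, hξ]; simp, hs_eq⟩

theorem norm_apply_le_of_mem_cstarStates {s : A →ₗ[ℂ] ℂ} (hs : s ∈ cstarStates A) (a : A) :
    ‖s a‖ ≤ ‖a‖ := by
  obtain ⟨H, _, _, _, π, ξ, hξ, rfl⟩ := exists_eq_vectorState hs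
  calc ‖inner ℂ ξ (π a ξ)‖ ≤ ‖ξ‖ * ‖π a ξ‖ := norm_inner_le_norm _ _
    _ ≤ ‖ξ‖ * (‖π a‖ * ‖ξ‖) := by gcongr; exact (π a).le_opNorm ξ
    _ = ‖π a‖ := by rw [hξ, one_mul, mul_one]
    _ ≤ ‖a‖ := NonUnitalStarAlgHom.norm_apply_le π a

theorem convex_cstarStates (A : Type u) [CStarAlgebra A] : Convex ℝ (cstarStates A) := by
  intro s hs t ht α β hα hβ hαβ
  refine ⟨?_, fun a => ?_⟩
  · simp only [LinearMap.add_apply, LinearMap.smul_apply, hs.1, ht.1, ← add_smul, hαβ, one_smul]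
  · exact add_nonneg (smul_nonneg hα (hs.2 a)) (smul_nonneg hβ (ht.2 a))

/-- The vectors of values that the states take on a family of elements. -/
def stateValues {ι : Type*} (a : ι → A) : Set (ι → ℂ) :=
  (fun (s : A →ₗ[ℂ] ℂ) i => s (a i)) '' cstarStates A

theorem convex_stateValues {ι : Type*} (a : ι → A) : Convex ℝ (stateValues a) :=
  (convex_cstarStates A).is_linear_image ⟨fun _ _ => rfl, fun _ _ => rfl⟩

theorem isCompact_image_coe_cstarStates (A : Type u) [CStarAlgebra A] :
    IsCompact ((fun (s : A →ₗ[ℂ] ℂ) (a : A) => s a) '' cstarStates A) := by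
  have hball : IsCompact (Set.univ.pi fun a : A => Metric.closedBall (0 : ℂ) ‖a‖) :=
    isCompact_univ_pi fun a => isCompact_closedBall 0 ‖a‖
  refine hball.of_isClosed_subset ?_ ?_
  · have hlin := LinearMap.isClosed_range_coe A ℂ (RingHom.id ℂ)
    have hone : IsClosed {f : A → ℂ | f 1 = 1} := isClosed_eq (continuous_apply 1) continuous_const
    have hpos : IsClosed {f : A → ℂ | ∀ a, 0 ≤ f (star a * a)} := by
      simp only [Set.ofPred_forall]
      exact isClosed_iInter fun a => isClosed_le continuous_const (continuous_apply _)
    convert hlin.inter (hone.inter hpos) using 1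
    ext f
    constructor
    · rintro ⟨s, hs, rfl⟩
      exact ⟨⟨s, rfl⟩, hs⟩
    · rintro ⟨⟨s, rfl⟩, hs⟩
      exact ⟨s, hs, rfl⟩
  · rintro _ ⟨s, hs, rfl⟩ a -
    simpa using norm_apply_le_of_mem_cstarStates hs a

theorem isClosed_stateValues {ι : Type*} (a : ι → A) : IsClosed (stateValues a) := by
  have hcont : Continuous fun (f : A → ℂ) i => f (a i) :=
    continuous_pi fun i => continuous_apply (a i)
  have := ((isCompact_image_coe_cstarStates A).image hcont).isClosed
  rwa [Set.image_image] at this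

theorem exists_eq_star_mul_self_of_coe {X : Set A} {x : cstarGen X} {c : A}
    (hc : (x : A) = star c * c) : ∃ y : cstarGen X, x = star y * y := by
  let _ : PartialOrder A := CStarAlgebra.spectralOrder A
  have _ : StarOrderedRing A := CStarAlgebra.spectralOrderedRing A
  let _ : PartialOrder (cstarGen X) := CStarAlgebra.spectralOrder _
  have _ : StarOrderedRing (cstarGen X) := CStarAlgebra.spectralOrderedRing _
  have hx : (0 : A) ≤ x := hc ▸ star_mul_self_nonneg c
  have hsa : IsSelfAdjoint x := Subtype.ext (IsSelfAdjoint.of_nonneg hx)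
  refine CStarAlgebra.nonneg_iff_eq_star_mul_self.1 ?_
  rw [StarOrderedRing.nonneg_iff_spectrum_nonneg (R := ℝ) _] at hx ⊢
  intro r hr
  refine hx r ?_
  rw [← spectrum.algebraMap_mem_iff ℂ] at hr ⊢
  exact (StarSubalgebra.mem_spectrum_iff (cstarGen X)).1 hr

end States

/-! ### Algebras of diagonal operators -/

section DiagOp

variable {I : Type*} {H : I → Type*} [∀ i, NormedAddCommGroup (H i)]
  [∀ i, InnerProductSpace ℂ (H i)] [∀ i, CompleteSpace (H i)] [∀ i, Nontrivial (H i)]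

/-- The projection of the algebra of diagonal operators onto a component. -/
def DiagOp.eval (i : I) : DiagOp H →⋆ₐ[ℂ] (H i →L[ℂ] H i) where
  toFun T := T.apply i
  map_one' := rfl
  map_mul' _ _ := rfl
  map_zero' := rfl
  map_add' _ _ := rfl
  commutes' _ := rfl
  map_star' _ := rfl

theorem DiagOp.exists_eq_star_mul_self {T : DiagOp H} (hT : ∀ i, (T.apply i).IsPositive) :
    ∃ R : DiagOp H, T = star R * R := by
  choose R hR using fun i => CStarAlgebra.nonneg_iff_eq_star_mul_self.1
    ((ContinuousLinearMap.nonneg_iff_isPositive _).2 (hT i))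
  have hb : ∀ i, ‖R i‖ ≤ √‖T‖ := fun i => Real.le_sqrt_of_sq_le <| by
    rw [sq, ← CStarRing.norm_star_mul_self, ← hR]
    exact NonUnitalStarAlgHom.norm_apply_le (DiagOp.eval i) T
  exact ⟨DiagOp.mk R _ hb, DiagOp.ext hR⟩

/-- The projection onto a component of a C*-algebra generated by diagonal operators. -/
def evalGen (X : Set (DiagOp H)) (i : I) : cstarGen X →⋆ₐ[ℂ] (H i →L[ℂ] H i) :=
  (DiagOp.eval i).comp (cstarGen X).subtype

theorem evalGen_ext {X : Set (DiagOp H)} {a b : cstarGen X}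
    (h : ∀ i, evalGen X i a = evalGen X i b) : a = b :=
  Subtype.ext (DiagOp.ext h)

theorem exists_eq_star_mul_self_of_evalGen {X : Set (DiagOp H)} {a : cstarGen X}
    (ha : ∀ i, (evalGen X i a).IsPositive) : ∃ b : cstarGen X, a = star b * b := by
  obtain ⟨R, hR⟩ := DiagOp.exists_eq_star_mul_self (T := a.1) ha
  exact exists_eq_star_mul_self_of_coe hR

end DiagOp

/-! ### Positive operators and positive operator matrices -/

section PositiveOperators

variable {H : Type} [NormedAddCommGroup H] [InnerProductSpace ℂ H]

theorem exists_norm_eq_one_inner_map_eq {ξ : H} (hξ : ξ ≠ 0) :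
    ∃ η : H, ‖η‖ = 1 ∧ ∀ T : H →L[ℂ] H, inner ℂ ξ (T ξ) = (‖ξ‖ : ℂ) ^ 2 * inner ℂ η (T η) := by
  have hnorm : (‖ξ‖ : ℂ) ≠ 0 := Complex.ofReal_ne_zero.2 (norm_ne_zero_iff.2 hξ)
  refine ⟨(‖ξ‖ : ℂ)⁻¹ • ξ, by simp [norm_smul, hξ], fun T => ?_⟩
  rw [map_smul, inner_smul_left, inner_smul_right, map_inv₀, Complex.conj_ofReal]
  field_simp

theorem isPositive_of_inner_nonneg {T : H →L[ℂ] H} (h : ∀ ξ, 0 ≤ inner ℂ ξ (T ξ)) :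
    T.IsPositive := by
  refine ContinuousLinearMap.isPositive_iff_complex T |>.2 fun ξ => ?_
  have h' : 0 ≤ inner ℂ (T ξ) ξ := by
    rw [← inner_conj_symm]
    exact star_nonneg_iff.2 (h ξ)
  obtain ⟨hre, him⟩ := Complex.nonneg_iff.1 h'
  exact ⟨Complex.ext rfl (by simpa using him), hre⟩

theorem isPositive_of_forall_unit {T : H →L[ℂ] H} (h : ∀ ξ, ‖ξ‖ = 1 → 0 ≤ inner ℂ ξ (T ξ)) :
    T.IsPositive := by
  refine isPositive_of_inner_nonneg fun ξ => ?_
  rcases eq_or_ne ξ 0 with rfl | hξ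
  · simp
  obtain ⟨η, hη, hT⟩ := exists_norm_eq_one_inner_map_eq hξ
  rw [hT T]
  exact mul_nonneg (by positivity) (h η hη)

theorem eq_zero_of_forall_unit {T : H →L[ℂ] H} (h : ∀ ξ, ‖ξ‖ = 1 → inner ℂ ξ (T ξ) = 0) :
    T = 0 := by
  have hall : ∀ ξ, inner ℂ (T ξ) ξ = 0 := fun ξ => by
    rcases eq_or_ne ξ 0 with rfl | hξ
    · simp
    obtain ⟨η, hη, hT⟩ := exists_norm_eq_one_inner_map_eq hξ
    rw [← inner_conj_symm, hT T, h η hη, mul_zero, map_zero]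
  exact ContinuousLinearMap.coe_injective (inner_map_self_eq_zero T.toLinearMap |>.1 hall)

theorem IsPositiveOpMatrix.zero {n : ℕ} :
    IsPositiveOpMatrix (0 : Matrix (Fin n) (Fin n) (H →L[ℂ] H)) := fun ξ => by simp

theorem IsPositiveOpMatrix.add {n : ℕ} {M N : Matrix (Fin n) (Fin n) (H →L[ℂ] H)}
    (hM : IsPositiveOpMatrix M) (hN : IsPositiveOpMatrix N) : IsPositiveOpMatrix (M + N) := by
  intro ξ
  simp only [Matrix.add_apply, add_apply, inner_add_right, Finset.sum_add_distrib]
  exact add_nonneg (hM ξ) (hN ξ)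

theorem IsPositiveOpMatrix.sum {n : ℕ} {ι : Type*} {s : Finset ι}
    {M : ι → Matrix (Fin n) (Fin n) (H →L[ℂ] H)} (hM : ∀ i ∈ s, IsPositiveOpMatrix (M i)) :
    IsPositiveOpMatrix (∑ i ∈ s, M i) :=
  Finset.sum_induction M IsPositiveOpMatrix (fun _ _ => .add) .zero hM

theorem IsPositiveOpMatrix.smul {n : ℕ} {M : Matrix (Fin n) (Fin n) (H →L[ℂ] H)} {c : ℂ}
    (hc : 0 ≤ c) (hM : IsPositiveOpMatrix M) : IsPositiveOpMatrix (c • M) := by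
  intro ξ
  simp only [Matrix.smul_apply, smul_apply, inner_smul_right, ← Finset.mul_sum]
  exact mul_nonneg hc (hM ξ)

theorem isPositiveOpMatrix_map_smul {n : ℕ} {M : Matrix (Fin n) (Fin n) ℂ} (hM : M.PosSemidef)
    {T : H →L[ℂ] H} (hT : T.IsPositive) : IsPositiveOpMatrix (M.map (· • T)) := by
  obtain ⟨m, v, rfl⟩ := Matrix.posSemidef_iff_eq_sum_vecMulVec.1 hM
  have hsum : (∑ k, Matrix.vecMulVec (v k) (star (v k))).map (· • T) =
      ∑ k, (Matrix.vecMulVec (v k) (star (v k))).map (· • T) := by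
    ext1 i j
    simp only [Matrix.map_apply, Matrix.sum_apply, Finset.sum_smul]
  rw [hsum]
  refine .sum fun k _ ξ => ?_
  have hrank_one : ∑ i, ∑ j,
      inner ℂ (ξ i) (((Matrix.vecMulVec (v k) (star (v k))).map (· • T)) i j (ξ j)) =
      inner ℂ (∑ i, star (v k i) • ξ i) (T (∑ j, star (v k j) • ξ j)) := by
    simp only [Matrix.map_apply, Matrix.vecMulVec_apply, Pi.star_apply, smul_apply, map_sum,
      map_smul, sum_inner, inner_sum, inner_smul_left, inner_smul_right, starRingEnd_apply,
      star_star]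
    refine Finset.sum_comm.trans (Finset.sum_congr rfl fun j _ => ?_)
    rw [Finset.mul_sum]
    exact Finset.sum_congr rfl fun i _ => by ring
  rw [hrank_one]
  exact hT.inner_nonneg_right _

end PositiveOperators

/-! ### Completely positive maps -/

section CompletelyPositive

variable {S : Type} [AddCommGroup S] [Module ℂ S] {O : MatrixOrder S}
  {H : Type} [NormedAddCommGroup H] [InnerProductSpace ℂ H]

theorem MatrixOrder.IsUCP.isPositive_apply {φ : S →ₗ[ℂ] H →L[ℂ] H} (hφ : O.IsUCP φ) {a : S}
    (ha : (Matrix.of fun _ _ : Fin 1 => a) ∈ O.cone 1) : (φ a).IsPositive :=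
  isPositive_of_inner_nonneg fun ξ => by simpa using hφ.2 1 _ ha fun _ => ξ

theorem MatrixOrder.IsUCP.liftQ {φ : S →ₗ[ℂ] H →L[ℂ] H} (hφ : O.IsUCP φ) {J : Submodule ℂ S}
    (hJ : J ≤ LinearMap.ker φ) : (O.quotient J).IsUCP (J.liftQ φ hJ) := by
  refine ⟨hφ.1, fun n M hM ξ => ?_⟩
  set c := ∑ i, ∑ j, inner ℂ (ξ i) (M.map (J.liftQ φ hJ) i j (ξ j))
  set d := ∑ i, inner ℂ (ξ i) (ξ i)
  have hperturbed : ∀ ε : ℝ, 0 < ε → 0 ≤ c + ε * d := fun ε hε => by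
    obtain ⟨u, rfl, hu⟩ := hM ε hε
    convert hφ.2 n _ hu ξ using 1
    simp only [c, d, Matrix.map_apply, Submodule.mkQ_apply, Submodule.liftQ_apply,
      Matrix.add_apply, map_add, add_apply, inner_add_right, Finset.sum_add_distrib,
      Finset.mul_sum]
    congr 1
    refine Finset.sum_congr rfl fun i _ => ?_
    rw [Finset.sum_eq_single i (fun j _ hj => by simp [Matrix.diagonal_apply_ne' _ hj]) (by simp),
      Matrix.diagonal_apply_eq, map_smul, hφ.1, smul_apply, one_apply_eq_self, inner_smul_right]
  have hlim : Filter.Tendsto (fun ε : ℝ => c + ε * d) (nhdsWithin 0 (Set.Ioi 0)) (nhds c) := by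
    have hcont : Continuous fun ε : ℝ => c + ε * d := by fun_prop
    simpa using (hcont.tendsto 0).mono_left nhdsWithin_le_nhds
  exact ge_of_tendsto hlim (eventually_mem_nhdsWithin.mono hperturbed)

/-- The compression `T ↦ w* T w` of operators by an isometry `w`. -/
def compression [CompleteSpace H] {L : Type} [NormedAddCommGroup L] [InnerProductSpace ℂ L]
    [CompleteSpace L] (w : L →ₗᵢ[ℂ] H) : (H →L[ℂ] H) →ₗ[ℂ] L →L[ℂ] L where
  toFun T := ContinuousLinearMap.adjoint w.toContinuousLinearMap ∘L T ∘L w.toContinuousLinearMap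
  map_add' S T := by rw [ContinuousLinearMap.add_comp, ContinuousLinearMap.comp_add]
  map_smul' c T := by
    rw [ContinuousLinearMap.smul_comp, ContinuousLinearMap.comp_smul, RingHom.id_apply]

theorem inner_compression [CompleteSpace H] {L : Type} [NormedAddCommGroup L]
    [InnerProductSpace ℂ L] [CompleteSpace L] (w : L →ₗᵢ[ℂ] H) (T : H →L[ℂ] H) (ξ η : L) :
    inner ℂ ξ (compression w T η) = inner ℂ (w ξ) (T (w η)) :=
  ContinuousLinearMap.adjoint_inner_right w.toContinuousLinearMap ξ (T (w η))

theorem MatrixOrder.IsUCP.compress [CompleteSpace H] {L : Type} [NormedAddCommGroup L]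
    [InnerProductSpace ℂ L] [CompleteSpace L] {φ : S →ₗ[ℂ] H →L[ℂ] H} (hφ : O.IsUCP φ)
    (w : L →ₗᵢ[ℂ] H) : O.IsUCP (compression w ∘ₗ φ) := by
  refine ⟨?_, fun n M hM ξ => ?_⟩
  · rw [LinearMap.comp_apply, hφ.1]
    exact w.adjoint_comp_self
  · simpa [inner_compression] using hφ.2 n M hM fun i => w (ξ i)

end CompletelyPositive

/-! ### The operator system of a scenario -/

section UniversalOperatorSystem

variable {V W : Type} (G : Scenario V) (K : Scenario W) {F : Type*} [AddCommGroup F] [Module ℂ F]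

theorem Scenario.card_edges_ne_zero : (G.edges.card : ℂ) ≠ 0 :=
  Nat.cast_ne_zero.2 G.nonempty.card_pos.ne'

/-- The pairing `u ↦ |E|⁻¹ ∑_e ∑_{x ∈ e} u^e_x a_x` of `⊕_e ℓ^∞_e` with a family of vectors. The
factor makes it unital for families whose sum over each hyperedge is the unit. -/
def Scenario.pairing (a : V → F) : G.LInfSum →ₗ[ℂ] F where
  toFun u := (G.edges.card : ℂ)⁻¹ • ∑ e : G.edges, ∑ x : e.1, u e x • a x
  map_add' u v := by simp only [Pi.add_apply, add_smul, Finset.sum_add_distrib, smul_add]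
  map_smul' c u := by
    simp only [Pi.smul_apply, smul_assoc, ← Finset.smul_sum, RingHom.id_apply]
    rw [smul_comm]

theorem Scenario.pairing_apply (a : V → F) (u : G.LInfSum) :
    G.pairing a u = (G.edges.card : ℂ)⁻¹ • ∑ e : G.edges, ∑ x : e.1, u e x • a x := rfl

theorem Scenario.pairing_single [DecidableEq V] (a : V → F) (e : G.edges) (x : e.1) :
    G.pairing a (Pi.single e (Pi.single x 1)) = (G.edges.card : ℂ)⁻¹ • a x := by
  rw [Scenario.pairing_apply, Finset.sum_eq_single e]
  · simp [Pi.single_apply]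
  · intro e' _ hne
    simp [Pi.single_eq_of_ne hne]
  · simp

theorem Scenario.pairing_one {a : V → F} {o : F} (ha : ∀ e ∈ G.edges, ∑ x ∈ e, a x = o) :
    G.pairing a 1 = o := by
  have hedge : ∀ e : G.edges, ∑ x : e.1, (1 : G.LInfSum) e x • a x = o := fun e => by
    simp only [Pi.one_apply, one_smul]
    rw [Finset.sum_coe_sort e.1 a, ha e.1 e.2]
  rw [Scenario.pairing_apply, Finset.sum_congr rfl fun e _ => hedge e, Finset.sum_const,
    Finset.card_univ, Fintype.card_coe, ← Nat.cast_smul_eq_nsmul ℂ, smul_smul,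
    inv_mul_cancel₀ G.card_edges_ne_zero, one_smul]

theorem Scenario.mem_kernel_iff {u : G.LInfSum} :
    u ∈ G.kernel ↔ ∀ p ∈ G.models, G.pairing (fun x => (p x : ℂ)) u = 0 := by
  refine forall₂_congr fun p _ => ?_
  simp only [Scenario.pairing_apply, smul_eq_mul, mul_eq_zero, inv_eq_zero, G.card_edges_ne_zero,
    false_or, mul_comm (p _ : ℂ)]

/-- The linear map on `S_G` that sends the generator `a_x` to `a x`, for a family `a` whose pairing
vanishes on `J̃`. -/
def Scenario.lift (a : V → F) (ha : G.kernel ≤ LinearMap.ker (G.pairing a)) : G.SG →ₗ[ℂ] F :=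
  G.kernel.liftQ (G.pairing a) ha

theorem Scenario.gen_eq_smul_mkQ [DecidableEq V] (e : G.edges) (x : e.1) :
    G.gen x = G.kernel.mkQ ((G.edges.card : ℂ) • Pi.single e (Pi.single x 1)) := by
  rw [map_smul, Scenario.gen, G.genOf_eq _ e x _ x.2, Scenario.genOf]
  congr!

theorem Scenario.lift_gen (a : V → F) (ha : G.kernel ≤ LinearMap.ker (G.pairing a)) (x : V) :
    G.lift a ha (G.gen x) = a x := by
  classical
  obtain ⟨e, he, hx⟩ := G.covers x
  rw [G.gen_eq_smul_mkQ ⟨e, he⟩ ⟨x, hx⟩]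
  change G.pairing a _ = a x
  rw [map_smul, Scenario.pairing_single, smul_inv_smul₀ G.card_edges_ne_zero]

theorem Scenario.pairing_gen : G.pairing G.gen = G.kernel.mkQ := by
  classical
  refine LinearMap.pi_ext' fun e => LinearMap.pi_ext' fun x => LinearMap.ext_ring ?_
  change G.pairing G.gen (Pi.single e (Pi.single x 1)) = G.kernel.mkQ (Pi.single e (Pi.single x 1))
  rw [Scenario.pairing_single, G.gen_eq_smul_mkQ e x, map_smul, inv_smul_smul₀ G.card_edges_ne_zero]

theorem Scenario.span_range_gen : Submodule.span ℂ (Set.range G.gen) = ⊤ := by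
  refine eq_top_iff.2 fun a _ => ?_
  obtain ⟨u, rfl⟩ := G.kernel.mkQ_surjective a
  rw [← G.pairing_gen]
  exact Submodule.smul_mem _ _ (Submodule.sum_mem _ fun e _ => Submodule.sum_mem _ fun x _ =>
    Submodule.smul_mem _ _ (Submodule.subset_span ⟨_, rfl⟩))

theorem Scenario.sum_gen {e : Finset V} (he : e ∈ G.edges) :
    ∑ x ∈ e, G.gen x = G.sgOrder.one := by
  classical
  rw [← Finset.sum_coe_sort, Finset.sum_congr rfl fun x _ => G.gen_eq_smul_mkQ ⟨e, he⟩ x, ← map_sum]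
  refine (Submodule.Quotient.eq _).2 (G.mem_kernel_iff.2 fun p hp => ?_)
  have hp_sum : ∀ f ∈ G.edges, ∑ x ∈ f, (p x : ℂ) = 1 := fun f hf => by exact_mod_cast hp.2 f hf
  have hsingle : ∀ x : e, G.pairing (fun x => (p x : ℂ))
      ((G.edges.card : ℂ) • Pi.single ⟨e, he⟩ (Pi.single x 1)) = p x := fun x => by
    rw [map_smul, Scenario.pairing_single, smul_inv_smul₀ G.card_edges_ne_zero]
  rw [map_sub, map_sum, Finset.sum_congr rfl fun x _ => hsingle x,
    Finset.sum_coe_sort e fun x => (p x : ℂ), hp_sum e he, sub_eq_zero]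
  exact (G.pairing_one hp_sum).symm

theorem Scenario.mkQ_mem_cone_of_nonneg {u : G.LInfSum} (hu : 0 ≤ u) :
    (Matrix.of fun _ _ : Fin 1 => G.kernel.mkQ u) ∈ G.sgOrder.cone 1 := by
  refine fun ε hε => ⟨Matrix.of fun _ _ => u, rfl, fun e x => ?_⟩
  have hdiag : ((Matrix.of fun _ _ => u) + Matrix.diagonal fun _ => (ε : ℂ) • G.lInfOrder.one :
      Matrix (Fin 1) (Fin 1) G.LInfSum).map (fun v => v e x) =
      Matrix.diagonal fun _ => u e x + ε := by
    ext i j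
    fin_cases i; fin_cases j
    simp [Scenario.lInfOrder]
  rw [hdiag, Matrix.posSemidef_diagonal_iff]
  exact fun _ => add_nonneg (hu e x) (Complex.zero_le_real.2 hε.le)

theorem Scenario.gen_mem_cone (x : V) :
    (Matrix.of fun _ _ : Fin 1 => G.gen x) ∈ G.sgOrder.cone 1 := by
  classical
  obtain ⟨e, he, hx⟩ := G.covers x
  rw [G.gen_eq_smul_mkQ ⟨e, he⟩ ⟨x, hx⟩]
  refine G.mkQ_mem_cone_of_nonneg (smul_nonneg (Nat.cast_nonneg _) ?_)
  exact Pi.single_nonneg.2 (Pi.single_nonneg.2 zero_le_one)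

variable {G K} in
theorem tensor_ext {f g : G.SG ⊗[ℂ] K.SG →ₗ[ℂ] F}
    (h : ∀ x y, f (G.gen x ⊗ₜ K.gen y) = g (G.gen x ⊗ₜ K.gen y)) : f = g :=
  TensorProduct.ext (LinearMap.ext_on_range G.span_range_gen fun x =>
    LinearMap.ext_on_range K.span_range_gen fun y => h x y)

end UniversalOperatorSystem

/-! ### Positive operator representations -/

section POR

variable {V : Type} {G : Scenario V} {H : Type} [NormedAddCommGroup H] [InnerProductSpace ℂ H]
  {A : V → H →L[ℂ] H}

theorem exists_ofReal_eq_of_nonneg {ι : Type*} {z : ι → ℂ} (hz : ∀ i, 0 ≤ z i) :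
    ∃ p : ι → ℝ, (∀ i, 0 ≤ p i) ∧ ∀ i, (p i : ℂ) = z i :=
  ⟨fun i => ‖z i‖, fun i => norm_nonneg (z i), fun i => (Complex.eq_coe_norm_of_nonneg (hz i)).symm⟩

theorem mem_models_of_nonneg {p : V → ℝ} (hpos : ∀ x, 0 ≤ p x)
    (hsum : ∀ e ∈ G.edges, ∑ x ∈ e, p x = 1) : p ∈ G.models := by
  refine ⟨fun x => ⟨hpos x, ?_⟩, hsum⟩
  obtain ⟨e, he, hx⟩ := G.covers x
  rw [← hsum e he]
  exact Finset.single_le_sum (fun y _ => hpos y) hx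

theorem IsPOR.exists_mem_models (hA : IsPOR G A) {ξ : H} (hξ : ‖ξ‖ = 1) :
    ∃ p ∈ G.models, ∀ x, (p x : ℂ) = inner ℂ ξ (A x ξ) := by
  obtain ⟨p, hpos, hp⟩ := exists_ofReal_eq_of_nonneg fun x => (hA.1 x).inner_nonneg_right ξ
  refine ⟨p, mem_models_of_nonneg hpos fun e he => Complex.ofReal_injective ?_, hp⟩
  calc ((∑ x ∈ e, p x : ℝ) : ℂ) = ∑ x ∈ e, inner ℂ ξ (A x ξ) := by
        simp only [Complex.ofReal_sum, hp]
    _ = inner ℂ ξ ((∑ x ∈ e, A x) ξ) := by rw [sum_apply, inner_sum]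
    _ = (1 : ℝ) := by simp [hA.2 e he, hξ]

theorem IsPOR.kernel_le (hA : IsPOR G A) : G.kernel ≤ LinearMap.ker (G.pairing A) := by
  refine fun u hu => eq_zero_of_forall_unit fun ξ hξ => ?_
  obtain ⟨p, hp, hval⟩ := hA.exists_mem_models hξ
  rw [← G.mem_kernel_iff.1 hu p hp]
  simp only [Scenario.pairing_apply, smul_apply, sum_apply, inner_smul_right, inner_sum, hval,
    smul_eq_mul]

theorem IsPOR.isUCP_pairing (hA : IsPOR G A) : G.lInfOrder.IsUCP (G.pairing A) := by
  refine ⟨G.pairing_one hA.2, fun n M hM => ?_⟩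
  have hdecomp : M.map (G.pairing A) = (G.edges.card : ℂ)⁻¹ • ∑ e : G.edges, ∑ x : e.1,
      (M.map fun v => v e x).map (· • A x) := by
    ext1 i j
    simp only [Matrix.map_apply, Scenario.pairing_apply, Matrix.smul_apply, Matrix.sum_apply]
  rw [hdecomp]
  exact .smul (by positivity) <| .sum fun e _ => .sum fun x _ =>
    isPositiveOpMatrix_map_smul (hM e x) (hA.1 x)

/-- The completely positive map `a_x ↦ A_x` on `S_G` given by a POR. -/
def IsPOR.map (hA : IsPOR G A) : G.SG →ₗ[ℂ] H →L[ℂ] H := G.lift A hA.kernel_le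

theorem IsPOR.isUCP_map (hA : IsPOR G A) : G.sgOrder.IsUCP hA.map :=
  hA.isUCP_pairing.liftQ hA.kernel_le

theorem IsPOR.map_gen (hA : IsPOR G A) (x : V) : hA.map (G.gen x) = A x :=
  G.lift_gen A hA.kernel_le x

theorem MatrixOrder.IsUCP.isPOR {φ : G.SG →ₗ[ℂ] H →L[ℂ] H} (hφ : G.sgOrder.IsUCP φ) :
    IsPOR G fun x => φ (G.gen x) :=
  ⟨fun x => hφ.isPositive_apply (G.gen_mem_cone x),
    fun e he => by rw [← map_sum, G.sum_gen he, hφ.1]⟩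

theorem IsPOR.norm_le_one [CompleteSpace H] (hA : IsPOR G A) (x : V) : ‖A x‖ ≤ 1 := by
  obtain ⟨e, he, hx⟩ := G.covers x
  have hnonneg : ∀ y, 0 ≤ A y := fun y => (ContinuousLinearMap.nonneg_iff_isPositive _).2 (hA.1 y)
  have hle : A x ≤ 1 := hA.2 e he ▸ Finset.single_le_sum (fun y _ => hnonneg y) hx
  exact (CStarAlgebra.norm_le_norm_of_nonneg_of_le (hnonneg x) hle).trans
    ContinuousLinearMap.norm_id_le

/-- A positive operator representation with values in an abstract C*-algebra. -/
def IsCStarPOR {B : Type*} [CStarAlgebra B] (G : Scenario V) (a : V → B) : Prop :=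
  (∀ x, ∃ c, a x = star c * c) ∧ ∀ e ∈ G.edges, ∑ x ∈ e, a x = 1

theorem IsCStarPOR.map [CompleteSpace H] {B : Type*} [CStarAlgebra B] {a : V → B}
    (ha : IsCStarPOR G a) (π : B →⋆ₐ[ℂ] (H →L[ℂ] H)) : IsPOR G fun x => π (a x) := by
  refine ⟨fun x => ?_, fun e he => by rw [← map_sum, ha.2 e he, map_one]⟩
  obtain ⟨c, hc⟩ := ha.1 x
  beta_reduce
  rw [hc, map_mul, map_star]
  exact ContinuousLinearMap.isPositive_adjoint_comp_self (π c)

section DiagOp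

variable {I : Type*} {L : I → Type} [∀ i, NormedAddCommGroup (L i)]
  [∀ i, InnerProductSpace ℂ (L i)] [∀ i, CompleteSpace (L i)] [∀ i, Nontrivial (L i)]
  {X : Set (DiagOp L)} {a : V → cstarGen X}

theorem isCStarPOR_of_evalGen (ha : ∀ i, IsPOR G fun x => evalGen X i (a x)) : IsCStarPOR G a :=
  ⟨fun x => exists_eq_star_mul_self_of_evalGen fun i => (ha i).1 x,
    fun e he => evalGen_ext fun i => by rw [map_sum, map_one]; exact (ha i).2 e he⟩

theorem kernel_le_of_evalGen (ha : ∀ i, IsPOR G fun x => evalGen X i (a x)) :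
    G.kernel ≤ LinearMap.ker (G.pairing a) := by
  refine fun u hu => evalGen_ext fun i => ?_
  have hu' := (ha i).kernel_le hu
  simp only [LinearMap.mem_ker, Scenario.pairing_apply] at hu'
  simp only [Scenario.pairing_apply, map_smul, map_sum, map_zero, hu']

end DiagOp

end POR

/-! ### Commuting pairs of positive operator representations -/

section Models

variable {V W : Type} {G : Scenario V} {K : Scenario W}

theorem mem_noSignalling_of_marginals {p : V × W → ℝ} (hp : ∀ z, 0 ≤ p z)
    {q : W → ℝ} (hq : q ∈ K.models) (hpq : ∀ e ∈ G.edges, ∀ y, ∑ x ∈ e, p (x, y) = q y)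
    {r : V → ℝ} (hpr : ∀ f ∈ K.edges, ∀ x, ∑ y ∈ f, p (x, y) = r x) : p ∈ noSignalling G K := by
  classical
  refine ⟨mem_models_of_nonneg hp fun d hd => ?_, fun y e he e' he' => by rw [hpq e he, hpq e' he'],
    fun x f hf f' hf' => by rw [hpr f hf, hpr f' hf']⟩
  obtain ⟨e, he, f, hf, rfl⟩ := Finset.mem_image₂.1 hd
  simp only [Finset.sum_product_right, hpq e he, hq.2 f hf]

/-- A POR of `G` and a POR of `K` on the same space whose operators commute with each other. -/
structure IsCommutingPOR {H : Type} [NormedAddCommGroup H] [InnerProductSpace ℂ H]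
    (G : Scenario V) (K : Scenario W) (A : V → H →L[ℂ] H) (B : W → H →L[ℂ] H) : Prop where
  left : IsPOR G A
  right : IsPOR K B
  comm : ∀ x y, A x * B y = B y * A x

section Values

variable {H : Type} [NormedAddCommGroup H] [InnerProductSpace ℂ H] [CompleteSpace H]

theorem isPositive_mul_of_commute {S T : H →L[ℂ] H} (hS : S.IsPositive) (hT : T.IsPositive)
    (h : S * T = T * S) : (S * T).IsPositive := by
  rw [← ContinuousLinearMap.nonneg_iff_isPositive] at *
  exact Commute.mul_nonneg hS hT h

variable {A : V → H →L[ℂ] H} {B : W → H →L[ℂ] H}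

theorem IsCommutingPOR.exists_mem_noSignalling (hAB : IsCommutingPOR G K A B) {ξ : H}
    (hξ : ‖ξ‖ = 1) :
    ∃ p ∈ noSignalling G K, ∀ x y, (p (x, y) : ℂ) = inner ℂ ξ ((A x * B y) ξ) := by
  obtain ⟨p, hpos, hp⟩ := exists_ofReal_eq_of_nonneg fun z : V × W =>
    (isPositive_mul_of_commute (hAB.left.1 z.1) (hAB.right.1 z.2)
      (hAB.comm z.1 z.2)).inner_nonneg_right ξ
  obtain ⟨q, hq, hqval⟩ := hAB.right.exists_mem_models hξ
  obtain ⟨r, -, hrval⟩ := hAB.left.exists_mem_models hξ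
  refine ⟨p, mem_noSignalling_of_marginals hpos hq (fun e he y => Complex.ofReal_injective ?_)
    (r := r) (fun f hf x => Complex.ofReal_injective ?_), fun x y => hp (x, y)⟩
  · simp only [Complex.ofReal_sum, hp, hqval, ← inner_sum, ← sum_apply, ← Finset.sum_mul,
      hAB.left.2 e he, one_mul]
  · simp only [Complex.ofReal_sum, hp, hrval, ← inner_sum, ← sum_apply, ← Finset.mul_sum,
      hAB.right.2 f hf, mul_one]

theorem IsCommutingPOR.exists_mem_genQC (hAB : IsCommutingPOR G K A B) {ξ : H} (hξ : ‖ξ‖ = 1) :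
    ∃ p ∈ genQC G K, ∀ x y, (p (x, y) : ℂ) = inner ℂ ξ ((A x * B y) ξ) := by
  obtain ⟨p, hp, hval⟩ := hAB.exists_mem_noSignalling hξ
  exact ⟨p, ⟨hp, H, inferInstance, inferInstance, inferInstance, A, B, ξ, hAB.left, hAB.right,
    hAB.comm, hξ, hval⟩, hval⟩

end Values

theorem IsCStarPOR.exists_mem_genQC_of_mem_cstarStates {C : Type} [CStarAlgebra C] {a : V → C}
    {b : W → C} (ha : IsCStarPOR G a) (hb : IsCStarPOR K b) (hab : ∀ x y, a x * b y = b y * a x)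
    {s : C →ₗ[ℂ] ℂ} (hs : s ∈ cstarStates C) :
    ∃ p ∈ genQC G K, ∀ x y, (p (x, y) : ℂ) = s (a x * b y) := by
  obtain ⟨H, _, _, _, π, ξ, hξ, rfl⟩ := exists_eq_vectorState hs
  have hcomm : IsCommutingPOR G K (fun x => π (a x)) fun y => π (b y) :=
    ⟨ha.map π, hb.map π, fun x y => by rw [← map_mul, hab, map_mul]⟩
  obtain ⟨p, hp, hval⟩ := hcomm.exists_mem_genQC hξ
  exact ⟨p, hp, fun x y => by rw [hval, vectorState_apply, map_mul]⟩

/- The algebra is generated by the direct sum of one realisation of every commuting model. -/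
theorem exists_toComplex_image_genQC_eq_stateValues (G : Scenario V) (K : Scenario W) :
    ∃ (C : Type) (_ : CStarAlgebra C) (c : V × W → C),
      toComplex '' genQC G K = stateValues c := by
  have hmodel : ∀ p : genQC G K, _ := fun p => p.2.2
  choose H _ _ _ A B ξ hA hB hAB hξ hval using hmodel
  have _ : ∀ p, Nontrivial (H p) := fun p => ⟨⟨ξ p, 0, fun h => by simpa [h] using hξ p⟩⟩
  let X : Set (DiagOp H) := Set.univ
  let a : V → cstarGen X := fun x =>
    ⟨DiagOp.mk (fun p => A p x) 1 fun p => (hA p).norm_le_one x, subset_cstarGen X trivial⟩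
  let b : W → cstarGen X := fun y =>
    ⟨DiagOp.mk (fun p => B p y) 1 fun p => (hB p).norm_le_one y, subset_cstarGen X trivial⟩
  have ha : IsCStarPOR G a := isCStarPOR_of_evalGen hA
  have hb : IsCStarPOR K b := isCStarPOR_of_evalGen hB
  have hab : ∀ x y, a x * b y = b y * a x := fun x y => evalGen_ext fun p => hAB p x y
  refine ⟨cstarGen X, inferInstance, fun z => a z.1 * b z.2, Set.Subset.antisymm ?_ ?_⟩
  · rintro _ ⟨p, hp, rfl⟩
    exact ⟨vectorState (evalGen X ⟨p, hp⟩) (ξ ⟨p, hp⟩), vectorState_mem_cstarStates _ (hξ _),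
      funext fun z => (hval ⟨p, hp⟩ z.1 z.2).symm⟩
  · rintro _ ⟨s, hs, rfl⟩
    obtain ⟨p, hp, hpval⟩ := ha.exists_mem_genQC_of_mem_cstarStates hb hab hs
    exact ⟨p, hp, funext fun z => hpval z.1 z.2⟩

theorem toComplex_injective : Function.Injective (toComplex : (V × W → ℝ) → V × W → ℂ) :=
  fun _ _ h => funext fun z => Complex.ofReal_injective (congrFun h z)

theorem isLinearMap_toComplex : IsLinearMap ℝ (toComplex : (V × W → ℝ) → V × W → ℂ) :=
  ⟨fun _ _ => funext fun _ => Complex.ofReal_add _ _,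
    fun _ _ => funext fun _ => Complex.ofReal_mul _ _⟩

theorem continuous_toComplex : Continuous (toComplex : (V × W → ℝ) → V × W → ℂ) :=
  continuous_pi fun z => Complex.continuous_ofReal.comp (continuous_apply z)

theorem convex_genQC (G : Scenario V) (K : Scenario W) : Convex ℝ (genQC G K) := by
  obtain ⟨C, _, c, h⟩ := exists_toComplex_image_genQC_eq_stateValues G K
  have hpre := (convex_stateValues c).is_linear_preimage isLinearMap_toComplex
  rwa [← h, Set.preimage_image_eq _ toComplex_injective] at hpre

theorem isClosed_genQC (G : Scenario V) (K : Scenario W) : IsClosed (genQC G K) := by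
  obtain ⟨C, _, c, h⟩ := exists_toComplex_image_genQC_eq_stateValues G K
  have hpre := (isClosed_stateValues c).preimage (continuous_toComplex (V := V) (W := W))
  rwa [← h, Set.preimage_image_eq _ toComplex_injective] at hpre

end Models

/-! ### Separation of states from closed convex sets of models -/

section Separation

theorem exists_separating_coefficients {ι : Type*} [Fintype ι] {C : Set (ι → ℝ)}
    (hconv : Convex ℝ C) (hclosed : IsClosed C) {p : ι → ℝ} (hp : p ∉ C) :
    ∃ (c : ι → ℝ) (α : ℝ), (∀ q ∈ C, α ≤ ∑ i, c i * q i) ∧ ∑ i, c i * p i < α := by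
  classical
  obtain ⟨f, α, hlt, hle⟩ := geometric_hahn_banach_point_closed hconv hclosed hp
  have hf : ∀ q, f q = ∑ i, f (Pi.single i 1) * q i := fun q => by
    conv_lhs => rw [pi_eq_sum_univ' q]
    simp [mul_comm]
  exact ⟨fun i => f (Pi.single i 1), α, fun q hq => (hf q ▸ hle q hq).le, hf p ▸ hlt⟩

/- Were the values of `s` outside `C`, a separating affine functional would give an element that is
positive, since it is so at all points of `C`, on which `s` is negative. -/
theorem exists_mem_of_mem_states {S : Type} [AddCommGroup S] [Module ℂ S] {O : MatrixOrder S}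
    {ι : Type*} [Finite ι] {t : ι → S} {C : Set (ι → ℝ)} (hconv : Convex ℝ C)
    (hclosed : IsClosed C) (hnonneg : ∀ p ∈ C, ∀ i, 0 ≤ p i)
    (hcone : ∀ a, (∀ f : S →ₗ[ℂ] ℂ, f O.one = 1 → (∃ p ∈ C, ∀ i, (p i : ℂ) = f (t i)) → 0 ≤ f a) →
      (Matrix.of fun _ _ : Fin 1 => a) ∈ O.cone 1)
    {s : S →ₗ[ℂ] ℂ} (hs : s ∈ O.states) : ∃ p ∈ C, ∀ i, (p i : ℂ) = s (t i) := by
  have := Fintype.ofFinite ι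
  obtain ⟨p, -, hp⟩ := exists_ofReal_eq_of_nonneg fun i => hs.2 _ <| hcone (t i) <| by
    rintro f - ⟨q, hq, hval⟩
    exact hval i ▸ Complex.zero_le_real.2 (hnonneg q hq i)
  refine ⟨p, by_contra fun hpC => ?_, hp⟩
  obtain ⟨c, α, hle, hlt⟩ := exists_separating_coefficients hconv hclosed hpC
  have happly : ∀ (f : S →ₗ[ℂ] ℂ) (q : ι → ℝ), f O.one = 1 → (∀ i, (q i : ℂ) = f (t i)) →
      f (∑ i, (c i : ℂ) • t i - (α : ℂ) • O.one) = (∑ i, c i * q i - α : ℝ) := fun f q hone hq => by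
    simp [hone, hq]
  have hpos := hs.2 _ <| hcone (∑ i, (c i : ℂ) • t i - (α : ℂ) • O.one) <| by
    rintro f hone ⟨q, hq, hval⟩
    rw [happly f q hone hval, Complex.zero_le_real]
    exact sub_nonneg.2 (hle q hq)
  rw [happly s p hs.1 hp, Complex.zero_le_real] at hpos
  linarith

theorem isPositiveOpMatrix_one_of_isPositive {H : Type} [NormedAddCommGroup H]
    [InnerProductSpace ℂ H] {M : Matrix (Fin 1) (Fin 1) (H →L[ℂ] H)} (hM : (M 0 0).IsPositive) :
    IsPositiveOpMatrix M := fun ξ => by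
  simpa using hM.inner_nonneg_right (ξ 0)

theorem exists_mem_genQC_of_mem_states {V W : Type} [Finite V] [Finite W] {G : Scenario V}
    {K : Scenario W} {s : G.SG ⊗[ℂ] K.SG →ₗ[ℂ] ℂ}
    (hs : s ∈ (G.sgOrder.commTensor K.sgOrder).states) :
    ∃ p ∈ genQC G K, toComplex p = pState G K s := by
  suffices h : ∃ p ∈ genQC G K, ∀ z : V × W, (p z : ℂ) = s (G.gen z.1 ⊗ₜ K.gen z.2) from
    h.imp fun p hp => ⟨hp.1, funext hp.2⟩
  refine exists_mem_of_mem_states (convex_genQC G K) (isClosed_genQC G K)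
    (fun p hp z => (hp.1.1.1 z).1) (fun a ha => ?_) hs
  intro H _ _ _ φ ψ hφ hψ hcomm
  refine isPositiveOpMatrix_one_of_isPositive (isPositive_of_forall_unit fun ξ hξ => ?_)
  have hAB : IsCommutingPOR G K (fun x => φ (G.gen x)) fun y => ψ (K.gen y) :=
    ⟨hφ.isPOR, hψ.isPOR, fun x y => hcomm _ _⟩
  refine ha (vectorFunctional ξ ∘ₗ opProd φ ψ) ?_ ?_
  · change inner ℂ ξ ((φ G.sgOrder.one * ψ K.sgOrder.one) ξ) = 1
    simp [hφ.1, hψ.1, hξ]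
  · obtain ⟨p, hp, hval⟩ := hAB.exists_mem_genQC hξ
    exact ⟨p, hp, fun z => hval z.1 z.2⟩

end Separation

/-! ### The universal property of `B_G` -/

section Universal

theorem countable_of_orthonormal {H ι : Type*} [NormedAddCommGroup H] [InnerProductSpace ℂ H]
    [TopologicalSpace.SeparableSpace H] {v : ι → H} (hv : Orthonormal ℂ v) : Countable ι := by
  have hdist : ∀ i j, i ≠ j → 1 ≤ dist (v i) (v j) := fun i j hij => by
    have hsq : ‖v i - v j‖ ^ 2 = 2 := by
      rw [norm_sub_sq (𝕜 := ℂ), hv.2 hij, hv.1, hv.1]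
      norm_num
    rw [dist_eq_norm]
    nlinarith [norm_nonneg (v i - v j)]
  refine Pairwise.countable_of_isOpen_disjoint (s := fun i => Metric.ball (v i) (1 / 2))
    (fun i j hij => Metric.ball_disjoint_ball ?_) (fun _ => Metric.isOpen_ball)
    fun i => ⟨v i, Metric.mem_ball_self one_half_pos⟩
  linarith [hdist i j hij]

theorem exists_linearIsometryEquiv_L2 (H : Type*) [NormedAddCommGroup H] [InnerProductSpace ℂ H]
    [CompleteSpace H] [Nontrivial H] [TopologicalSpace.SeparableSpace H] :
    ∃ D : Set ℝ, D.Nonempty ∧ Nonempty (H ≃ₗᵢ[ℂ] L2 D) := by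
  obtain ⟨w, b, -⟩ := exists_hilbertBasis ℂ H
  have _ : Countable w := countable_of_orthonormal b.orthonormal
  obtain ⟨f, hf⟩ := exists_injective_nat w
  let σ : w ≃ Set.range fun i => (f i : ℝ) := Equiv.ofInjective _ (Nat.cast_injective.comp hf)
  have hspan : ⊤ ≤ (Submodule.span ℂ (Set.range (b ∘ σ.symm))).topologicalClosure := by
    rw [σ.symm.surjective.range_comp, b.dense_span]
  let b' : HilbertBasis (Set.range fun i => (f i : ℝ)) ℂ H :=
    HilbertBasis.mk (b.orthonormal.comp _ σ.symm.injective) hspan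
  refine ⟨_, ?_, ⟨b'.repr⟩⟩
  by_contra hempty
  have _ : IsEmpty (Set.range fun i => (f i : ℝ)) :=
    Set.isEmpty_coe_sort.2 (Set.not_nonempty_iff_eq_empty.1 hempty)
  have _ : Subsingleton H := b'.repr.toEquiv.subsingleton
  exact not_subsingleton H ‹_›

variable {V W : Type} {G : Scenario V} {K : Scenario W}

theorem Scenario.TernaryRep.isPOR (θ : G.TernaryRep) :
    IsPOR G fun x => (ContinuousLinearMap.adjoint (θ.U x)) ∘L (θ.U x) :=
  ⟨fun x => ContinuousLinearMap.isPositive_adjoint_comp_self (θ.U x), θ.sum_eq⟩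

theorem isCStarPOR_bgen (G : Scenario V) : IsCStarPOR G G.bgen :=
  isCStarPOR_of_evalGen fun θ => θ.isPOR

theorem IsPOR.exists_starAlgHom_g_eq {H : Type} [NormedAddCommGroup H] [InnerProductSpace ℂ H]
    [CompleteSpace H] [Nontrivial H] [TopologicalSpace.SeparableSpace H] {A : V → H →L[ℂ] H}
    (hA : IsPOR G A) :
    ∃ π : DiagOp (fun θ : G.TernaryRep => θ.space) →⋆ₐ[ℂ] (H →L[ℂ] H), ∀ x, π (G.g x x) = A x := by
  obtain ⟨D, hD, ⟨Ψ⟩⟩ := exists_linearIsometryEquiv_L2 H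
  choose R hR using fun x => CStarAlgebra.nonneg_iff_eq_star_mul_self.1
    ((ContinuousLinearMap.nonneg_iff_isPositive _).2 (hA.1 x))
  have hU : ∀ x, (ContinuousLinearMap.adjoint (Ψ.conjStarAlgEquiv (R x))) ∘L
      (Ψ.conjStarAlgEquiv (R x)) = Ψ.conjStarAlgEquiv (A x) := fun x => by
    change star (Ψ.conjStarAlgEquiv (R x)) * Ψ.conjStarAlgEquiv (R x) = _
    rw [← map_star, ← map_mul, ← hR]
  let θ : G.TernaryRep :=
    { dom := D
      cod := D
      dom_nonempty := hD
      U := fun x => Ψ.conjStarAlgEquiv (R x)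
      sum_eq := fun e he => by
        rw [Finset.sum_congr rfl fun x _ => hU x, ← map_sum, hA.2 e he, map_one] }
  refine ⟨(StarAlgHomClass.toStarAlgHom Ψ.conjStarAlgEquiv.symm).comp (DiagOp.eval θ), fun x => ?_⟩
  change Ψ.conjStarAlgEquiv.symm ((ContinuousLinearMap.adjoint (θ.U x)) ∘L (θ.U x)) = A x
  rw [hU, StarAlgEquiv.symm_apply_apply]

theorem commute_map_of_mem_cstarGen {A B : Type*} [CStarAlgebra A] [CStarAlgebra B]
    (σ : A →⋆ₐ[ℂ] B) {X : Set A} {t : B} (ht : ∀ x ∈ X, Commute t (σ x))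
    (ht' : ∀ x ∈ X, Commute (star t) (σ x)) {a : A} (ha : a ∈ cstarGen X) : Commute t (σ a) := by
  have hσ : Continuous σ := AddMonoidHomClass.continuous_of_bound σ 1 fun a => by
    simpa only [one_mul] using NonUnitalStarAlgHom.norm_apply_le σ a
  have hclosed : IsClosed ((StarSubalgebra.centralizer ℂ {t}).comap σ : Set A) := by
    rw [StarSubalgebra.coe_comap, StarSubalgebra.coe_centralizer]
    exact (Set.isClosed_centralizer _).preimage hσ
  have hle : cstarGen X ≤ (StarSubalgebra.centralizer ℂ {t}).comap σ :=
    StarSubalgebra.topologicalClosure_minimal (StarAlgebra.adjoin_le fun x hx =>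
      (StarSubalgebra.mem_centralizer_iff ℂ).2 (by rintro _ rfl; exact ⟨ht x hx, ht' x hx⟩)) hclosed
  exact ((StarSubalgebra.mem_centralizer_iff ℂ).1 (hle ha) t rfl).1

theorem commute_map_map_of_mem_cstarGen {A B C : Type*} [CStarAlgebra A] [CStarAlgebra B]
    [CStarAlgebra C] (π : A →⋆ₐ[ℂ] C) (ρ : B →⋆ₐ[ℂ] C) {X : Set A} {Y : Set B}
    (hX : ∀ x ∈ X, IsSelfAdjoint (π x)) (h : ∀ x ∈ X, ∀ y ∈ Y, Commute (π x) (ρ y))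
    {a : A} (ha : a ∈ cstarGen X) {b : B} (hb : b ∈ cstarGen Y) : Commute (π a) (ρ b) := by
  have hright : ∀ b ∈ cstarGen Y, ∀ x ∈ X, Commute (π x) (ρ b) := fun b hb x hx =>
    commute_map_of_mem_cstarGen ρ (h x hx) (fun y hy => (hX x hx).star_eq.symm ▸ h x hx y hy) hb
  refine (commute_map_of_mem_cstarGen π (fun x hx => (hright b hb x hx).symm) (fun x hx => ?_)
    ha).symm
  rw [← map_star]
  exact (hright (star b) (star_mem hb) x hx).symm

end Universal

/-! ### Completed tensor products -/

section Completion

variable {A B : Type} [CStarAlgebra A] [CStarAlgebra B] {𝓕 : CommRep A B → Prop}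

theorem evalGen_tmul (P : {P : CommRep A B // 𝓕 P}) (a : A) (b : B) :
    evalGen _ P (tensorCompletion.tmul 𝓕 a b) = P.1.π a * P.1.ρ b := rfl

theorem exists_state_tmul_eq_inner (P : CommRep A B) (hP : 𝓕 P) {ξ : P.H} (hξ : ‖ξ‖ = 1) :
    ∃ s ∈ cstarStates (tensorCompletion A B 𝓕),
      ∀ a b, s (tensorCompletion.tmul 𝓕 a b) = inner ℂ ξ ((P.π a * P.ρ b) ξ) :=
  ⟨vectorState (evalGen _ (⟨P, hP⟩ : {P : CommRep A B // 𝓕 P})) ξ,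
    vectorState_mem_cstarStates _ hξ, fun _ _ => rfl⟩

theorem tensorCompletion.tmul_one_one : tensorCompletion.tmul 𝓕 (1 : A) (1 : B) = 1 :=
  evalGen_ext fun P => by rw [evalGen_tmul, map_one, map_one, map_one, one_mul]

variable (A B 𝓕) in
/-- The canonical map from the algebraic tensor product `A ⊗ B` to a completion. -/
def tensorCompletion.ofTensor : A ⊗[ℂ] B →ₗ[ℂ] tensorCompletion A B 𝓕 :=
  TensorProduct.lift (LinearMap.mk₂ ℂ (tensorCompletion.tmul 𝓕)
    (fun a a' b => evalGen_ext fun P => by simp only [map_add, evalGen_tmul, add_mul])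
    (fun c a b => evalGen_ext fun P => by simp only [map_smul, evalGen_tmul, smul_mul_assoc])
    (fun a b b' => evalGen_ext fun P => by simp only [map_add, evalGen_tmul, mul_add])
    (fun c a b => evalGen_ext fun P => by simp only [map_smul, evalGen_tmul, mul_smul_comm]))

theorem tensorCompletion.ofTensor_tmul (a : A) (b : B) :
    tensorCompletion.ofTensor A B 𝓕 (a ⊗ₜ b) = tensorCompletion.tmul 𝓕 a b := rfl

end Completion

/-! ### Commuting models as states of the maximal tensor product -/

section Separable

variable {V W : Type} {G : Scenario V} {K : Scenario W}
  {H : Type} [NormedAddCommGroup H] [InnerProductSpace ℂ H]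

theorem exists_separable_invariant_submodule {ι : Type*} [Countable ι] (T : ι → H →L[ℂ] H) (ξ : H) :
    ∃ L : Submodule ℂ H, ξ ∈ L ∧ IsClosed (L : Set H) ∧ TopologicalSpace.SeparableSpace L ∧
      ∀ i, ∀ η ∈ L, T i η ∈ L := by
  let orbit : List ι → H := fun l => (l.map T).prod ξ
  let L := (Submodule.span ℂ (Set.range orbit)).topologicalClosure
  have hmem : ∀ l, orbit l ∈ L := fun l =>
    Submodule.le_topologicalClosure _ (Submodule.subset_span ⟨l, rfl⟩)
  have hclosed : IsClosed (L : Set H) := Submodule.isClosed_topologicalClosure _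
  have hsep : TopologicalSpace.IsSeparable (L : Set H) :=
    ((Set.countable_range orbit).isSeparable.span (R := ℂ)).closure
  have hinv : ∀ i, L ≤ L.comap (T i).toLinearMap := fun i =>
    Submodule.topologicalClosure_minimal _
      (Submodule.span_le.2 (Set.range_subset_iff.2 fun l => hmem (i :: l)))
      (hclosed.preimage (T i).continuous)
  exact ⟨L, hmem [], hclosed, hsep.separableSpace, hinv⟩

variable [CompleteSpace H] {L : Type} [NormedAddCommGroup L] [InnerProductSpace ℂ L]
  [CompleteSpace L] {A : V → H →L[ℂ] H} {B : W → H →L[ℂ] H}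

theorem IsPOR.compress (hA : IsPOR G A) (w : L →ₗᵢ[ℂ] H) :
    IsPOR G fun x => compression w (A x) :=
  ⟨fun x => isPositive_of_inner_nonneg fun ξ => inner_compression w (A x) ξ ξ ▸
    (hA.1 x).inner_nonneg_right (w ξ), fun e he => by
      rw [← map_sum, hA.2 e he]
      exact w.adjoint_comp_self⟩

theorem apply_compression_apply {w : L →ₗᵢ[ℂ] H} {T : H →L[ℂ] H} {ξ : L}
    (hξ : T (w ξ) ∈ Set.range w) : w (compression w T ξ) = T (w ξ) := by
  obtain ⟨η, hη⟩ := hξ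
  have hcomp : compression w T ξ = η := ext_inner_left ℂ fun ζ => by
    rw [inner_compression, ← hη, w.inner_map_map]
  rw [hcomp, hη]

theorem IsCommutingPOR.compress (hAB : IsCommutingPOR G K A B) (w : L →ₗᵢ[ℂ] H)
    (hA : ∀ x ξ, A x (w ξ) ∈ Set.range w) (hB : ∀ y ξ, B y (w ξ) ∈ Set.range w) :
    IsCommutingPOR G K (fun x => compression w (A x)) fun y => compression w (B y) := by
  refine ⟨hAB.left.compress w, hAB.right.compress w, fun x y => ?_⟩
  ext ξ
  apply w.injective
  simp only [mul_apply_eq_comp, apply_compression_apply (hA x _),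
    apply_compression_apply (hB y _)]
  exact DFunLike.congr_fun (hAB.comm x y) (w ξ)

theorem exists_separable_realisation [Countable V] [Countable W] {p : V × W → ℝ}
    (hp : p ∈ genQC G K) :
    ∃ (H : Type) (_ : NormedAddCommGroup H) (_ : InnerProductSpace ℂ H) (_ : CompleteSpace H)
      (_ : TopologicalSpace.SeparableSpace H) (A : V → H →L[ℂ] H) (B : W → H →L[ℂ] H) (ξ : H),
      IsCommutingPOR G K A B ∧ ‖ξ‖ = 1 ∧ ∀ x y, (p (x, y) : ℂ) = inner ℂ ξ ((A x * B y) ξ) := by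
  obtain ⟨-, H, _, _, _, A, B, ξ, hA, hB, hAB, hξ, hval⟩ := hp
  obtain ⟨L, hξL, hclosed, hsep, hinv⟩ := exists_separable_invariant_submodule (Sum.elim A B) ξ
  have _ : CompleteSpace L := hclosed.completeSpace_coe
  have hrange : ∀ i (η : L), Sum.elim A B i η ∈ Set.range L.subtypeₗᵢ := fun i η =>
    ⟨⟨_, hinv i η η.2⟩, rfl⟩
  refine ⟨L, inferInstance, inferInstance, inferInstance, hsep, _, _, ⟨ξ, hξL⟩,
    IsCommutingPOR.compress ⟨hA, hB, hAB⟩ L.subtypeₗᵢ (fun x => hrange (.inl x))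
      fun y => hrange (.inr y), hξ, fun x y => ?_⟩
  rw [hval, mul_apply_eq_comp, mul_apply_eq_comp, inner_compression,
    apply_compression_apply (T := B y) (hrange (.inr y) _)]
  rfl

theorem exists_cstarMaxTensor_state_of_mem_genQC [Countable V] [Countable W] {p : V × W → ℝ}
    (hp : p ∈ genQC G K) :
    ∃ s ∈ cstarStates (MaxTensor G.BG K.BG), toComplex p = pStateB G K s := by
  have hreal := exists_separable_realisation hp
  obtain ⟨H, _, _, _, _, A, B, ξ, hAB, hξ, hval⟩ := hreal
  have _ : Nontrivial H := ⟨⟨ξ, 0, fun h => by simp [h] at hξ⟩⟩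
  have hπ := hAB.left.exists_starAlgHom_g_eq
  have hρ := hAB.right.exists_starAlgHom_g_eq
  obtain ⟨π, hπ⟩ := hπ
  obtain ⟨ρ, hρ⟩ := hρ
  have hcomm : ∀ (a : G.BG) (b : K.BG), π a * ρ b = ρ b * π a := fun a b =>
    commute_map_map_of_mem_cstarGen π ρ
      (by rintro _ ⟨x, rfl⟩; exact (hπ x).symm ▸ (hAB.left.1 x).isSelfAdjoint)
      (by rintro _ ⟨x, rfl⟩ _ ⟨y, rfl⟩; exact hπ x ▸ hρ y ▸ hAB.comm x y) a.2 b.2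
  let P : CommRep G.BG K.BG :=
    { H := H, π := π.comp G.BG.subtype, ρ := ρ.comp K.BG.subtype, comm := hcomm }
  have hstate := exists_state_tmul_eq_inner (𝓕 := fun _ => True) P trivial hξ
  obtain ⟨s, hs, hsval⟩ := hstate
  refine ⟨s, hs, funext fun z => Eq.trans ?_ (hsval (G.bgen z.1) (K.bgen z.2)).symm⟩
  change (p z : ℂ) = inner ℂ ξ ((π (G.g z.1 z.1) * ρ (K.g z.2 z.2)) ξ)
  rw [hπ, hρ, hval]

end Separable

/-! ### Restriction of states to operator systems -/

section OpTensor

variable {S T : Type} [AddCommGroup S] [Module ℂ S] [AddCommGroup T] [Module ℂ T]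
  {O : MatrixOrder S} {P : MatrixOrder T}
  {H H₁ H₂ : Type} [NormedAddCommGroup H] [InnerProductSpace ℂ H]
  [NormedAddCommGroup H₁] [InnerProductSpace ℂ H₁] [NormedAddCommGroup H₂] [InnerProductSpace ℂ H₂]

theorem opProd_apply_of_intertwines {φ : S →ₗ[ℂ] H →L[ℂ] H} {ψ : T →ₗ[ℂ] H →L[ℂ] H}
    {φ₀ : S →ₗ[ℂ] H₁ →L[ℂ] H₁} {ψ₀ : T →ₗ[ℂ] H₂ →L[ℂ] H₂} {J : H₁ ⊗[ℂ] H₂ →ₗ[ℂ] H}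
    (hφ : ∀ a ξ η, φ a (J (ξ ⊗ₜ η)) = J (φ₀ a ξ ⊗ₜ η))
    (hψ : ∀ b ξ η, ψ b (J (ξ ⊗ₜ η)) = J (ξ ⊗ₜ ψ₀ b η)) (t : S ⊗[ℂ] T) (ζ : H₁ ⊗[ℂ] H₂) :
    opProd φ ψ t (J ζ) = J (opTensor φ₀ ψ₀ t ζ) := by
  induction t with
  | zero => simp
  | add t u ht hu => simp only [map_add, add_apply, ht, hu]
  | tmul a b =>
    induction ζ with
    | zero => simp
    | add ζ ζ' h h' => simp only [map_add, h, h']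
    | tmul ξ η =>
      change φ a (ψ b (J (ξ ⊗ₜ η))) = J (φ₀ a ξ ⊗ₜ ψ₀ b η)
      rw [hψ, hφ]

theorem inner_opTensor_compression [CompleteSpace H₁] [CompleteSpace H₂] {L₁ L₂ : Type}
    [NormedAddCommGroup L₁] [InnerProductSpace ℂ L₁] [CompleteSpace L₁]
    [NormedAddCommGroup L₂] [InnerProductSpace ℂ L₂] [CompleteSpace L₂]
    (φ : S →ₗ[ℂ] H₁ →L[ℂ] H₁) (ψ : T →ₗ[ℂ] H₂ →L[ℂ] H₂) (v : L₁ →ₗᵢ[ℂ] H₁) (w : L₂ →ₗᵢ[ℂ] H₂)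
    (t : S ⊗[ℂ] T) (η η' : L₁ ⊗[ℂ] L₂) :
    inner ℂ η (opTensor (compression v ∘ₗ φ) (compression w ∘ₗ ψ) t η') =
      inner ℂ (TensorProduct.mapIsometry v w η)
        (opTensor φ ψ t (TensorProduct.mapIsometry v w η')) := by
  induction t with
  | zero => simp
  | add t u ht hu => simp only [map_add, add_apply, inner_add_right, ht, hu]
  | tmul a b =>
    induction η with
    | zero => simp
    | add ζ ζ' h h' => simp only [map_add, inner_add_left, h, h']
    | tmul ξ₁ ξ₂ =>
      induction η' with
      | zero => simp
      | add ζ ζ' h h' => simp only [map_add, inner_add_right, h, h']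
      | tmul η₁ η₂ =>
        change inner ℂ (ξ₁ ⊗ₜ[ℂ] ξ₂) (compression v (φ a) η₁ ⊗ₜ[ℂ] compression w (ψ b) η₂) =
          inner ℂ (v ξ₁ ⊗ₜ[ℂ] w ξ₂) (φ a (v η₁) ⊗ₜ[ℂ] ψ b (w η₂))
        simp only [TensorProduct.inner_tmul, inner_compression]

theorem exists_eq_mapIsometry (ζ : H₁ ⊗[ℂ] H₂) :
    ∃ (k l : ℕ) (v : EuclideanSpace ℂ (Fin k) →ₗᵢ[ℂ] H₁) (w : EuclideanSpace ℂ (Fin l) →ₗᵢ[ℂ] H₂)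
      (η : EuclideanSpace ℂ (Fin k) ⊗[ℂ] EuclideanSpace ℂ (Fin l)),
      ζ = TensorProduct.mapIsometry v w η := by
  obtain ⟨M, N, _, _, h⟩ := TensorProduct.exists_finite_submodule_of_setFinite {ζ}
    (Set.finite_singleton ζ)
  obtain ⟨η, hη⟩ := h rfl
  let e := (stdOrthonormalBasis ℂ M).repr
  let f := (stdOrthonormalBasis ℂ N).repr
  refine ⟨_, _, M.subtypeₗᵢ.comp e.symm.toLinearIsometry, N.subtypeₗᵢ.comp f.symm.toLinearIsometry,
    TensorProduct.map e.toLinearEquiv.toLinearMap f.toLinearEquiv.toLinearMap η, ?_⟩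
  rw [TensorProduct.mapIsometry_apply, ← LinearMap.comp_apply, ← TensorProduct.map_comp, ← hη,
    TensorProduct.mapIncl]
  congr 2 <;> ext x <;> simp [e, f]

/- A vector of the algebraic tensor product involves finite dimensional subspaces only, so that the
matrix-valued maps in the definition of the minimal cone suffice. -/
theorem inner_opTensor_nonneg [CompleteSpace H₁] [CompleteSpace H₂] {φ : S →ₗ[ℂ] H₁ →L[ℂ] H₁}
    {ψ : T →ₗ[ℂ] H₂ →L[ℂ] H₂} (hφ : O.IsUCP φ) (hψ : P.IsUCP ψ) {t : S ⊗[ℂ] T}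
    (ht : (Matrix.of fun _ _ : Fin 1 => t) ∈ (O.minTensor P).cone 1) (ζ : H₁ ⊗[ℂ] H₂) :
    0 ≤ inner ℂ ζ (opTensor φ ψ t ζ) := by
  obtain ⟨k, l, v, w, η, rfl⟩ := exists_eq_mapIsometry ζ
  rw [← inner_opTensor_compression]
  simpa using ht k l _ _ (hφ.compress v) (hψ.compress w) fun _ => η

theorem isPositive_of_denseRange {X : Type*} {R : H →L[ℂ] H} {J : X → H} (hJ : DenseRange J)
    (h : ∀ ζ, 0 ≤ inner ℂ (J ζ) (R (J ζ))) : R.IsPositive :=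
  isPositive_of_inner_nonneg fun ξ => hJ.induction_on (p := fun ξ => 0 ≤ inner ℂ ξ (R ξ)) ξ
    (isClosed_le continuous_const (continuous_id.inner R.continuous)) h

end OpTensor

/-- A unital completely positive map from an operator system into an abstract C*-algebra; complete
positivity is tested in the representations of the algebra. -/
structure MatrixOrder.IsCStarUCP {S A : Type} [AddCommGroup S] [Module ℂ S] [CStarAlgebra A]
    (O : MatrixOrder S) (ι : S →ₗ[ℂ] A) : Prop where
  map_one : ι O.one = 1
  isUCP : ∀ (H : Type) [NormedAddCommGroup H] [InnerProductSpace ℂ H] [CompleteSpace H]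
    (π : A →⋆ₐ[ℂ] (H →L[ℂ] H)), O.IsUCP (π.toAlgHom.toLinearMap ∘ₗ ι)

section Restriction

variable {A B : Type} [CStarAlgebra A] [CStarAlgebra B] {𝓕 : CommRep A B → Prop}
  {S T : Type} [AddCommGroup S] [Module ℂ S] [AddCommGroup T] [Module ℂ T]
  {O : MatrixOrder S} {P : MatrixOrder T} {ι : S →ₗ[ℂ] A} {κ : T →ₗ[ℂ] B}

theorem evalGen_ofTensor (R : {R : CommRep A B // 𝓕 R}) (t : A ⊗[ℂ] B) :
    evalGen _ R (tensorCompletion.ofTensor A B 𝓕 t) =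
      opProd R.1.π.toAlgHom.toLinearMap R.1.ρ.toAlgHom.toLinearMap t := by
  induction t with
  | zero => simp only [map_zero]
  | add t u ht hu => simp only [map_add, ht, hu]
  | tmul a b => rfl

theorem comp_ofTensor_mem_states {Q : MatrixOrder (S ⊗[ℂ] T)} (hone : Q.one = O.one ⊗ₜ P.one)
    (hι : ι O.one = 1) (hκ : κ P.one = 1)
    (hpos : ∀ R : CommRep A B, 𝓕 R → ∀ t, (Matrix.of fun _ _ : Fin 1 => t) ∈ Q.cone 1 →
      (opProd (R.π.toAlgHom.toLinearMap ∘ₗ ι) (R.ρ.toAlgHom.toLinearMap ∘ₗ κ) t).IsPositive)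
    {s : tensorCompletion A B 𝓕 →ₗ[ℂ] ℂ} (hs : s ∈ cstarStates (tensorCompletion A B 𝓕)) :
    s ∘ₗ tensorCompletion.ofTensor A B 𝓕 ∘ₗ TensorProduct.map ι κ ∈ Q.states := by
  refine ⟨?_, fun t ht => ?_⟩
  · rw [LinearMap.comp_apply, LinearMap.comp_apply, hone, TensorProduct.map_tmul, hι, hκ,
      tensorCompletion.ofTensor_tmul, tensorCompletion.tmul_one_one, hs.1]
  · have hsquare : ∃ c, tensorCompletion.ofTensor A B 𝓕 (TensorProduct.map ι κ t) = star c * c := by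
      refine exists_eq_star_mul_self_of_evalGen fun R => ?_
      rw [evalGen_ofTensor]
      convert hpos R.1 R.2 t ht using 1
      rw [opProd, opProd, TensorProduct.map_comp]
      rfl
    obtain ⟨c, hc⟩ := hsquare
    rw [LinearMap.comp_apply, LinearMap.comp_apply, hc]
    exact hs.2 c

theorem comp_ofTensor_mem_states_commTensor (hι : O.IsCStarUCP ι) (hκ : P.IsCStarUCP κ)
    {s : MaxTensor A B →ₗ[ℂ] ℂ} (hs : s ∈ cstarStates (MaxTensor A B)) :
    s ∘ₗ tensorCompletion.ofTensor A B _ ∘ₗ TensorProduct.map ι κ ∈ (O.commTensor P).states := by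
  refine comp_ofTensor_mem_states rfl hι.map_one hκ.map_one (fun R _ t ht => ?_) hs
  refine isPositive_of_inner_nonneg fun ξ => ?_
  simpa using ht R.H _ _ (hι.isUCP R.H R.π) (hκ.isUCP R.H R.ρ) (fun a b => R.comm (ι a) (κ b))
    fun _ => ξ

theorem comp_ofTensor_mem_states_minTensor (hι : O.IsCStarUCP ι) (hκ : P.IsCStarUCP κ)
    {s : MinTensor A B →ₗ[ℂ] ℂ} (hs : s ∈ cstarStates (MinTensor A B)) :
    s ∘ₗ tensorCompletion.ofTensor A B _ ∘ₗ TensorProduct.map ι κ ∈ (O.minTensor P).states := by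
  refine comp_ofTensor_mem_states rfl hι.map_one hκ.map_one (fun R hR t ht => ?_) hs
  obtain ⟨H₁, _, _, _, H₂, _, _, _, π₀, ρ₀, J, hJ, hπ, hρ⟩ := hR
  refine isPositive_of_denseRange hJ fun ζ => ?_
  have hJt := opProd_apply_of_intertwines (J := J.toLinearMap)
    (φ := R.π.toAlgHom.toLinearMap ∘ₗ ι) (ψ := R.ρ.toAlgHom.toLinearMap ∘ₗ κ)
    (φ₀ := π₀.toAlgHom.toLinearMap ∘ₗ ι) (ψ₀ := ρ₀.toAlgHom.toLinearMap ∘ₗ κ)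
    (fun a => hπ (ι a)) (fun b => hρ (κ b)) t ζ
  rw [LinearIsometry.coe_toLinearMap] at hJt
  rw [hJt, J.inner_map_map]
  exact inner_opTensor_nonneg (hι.isUCP H₁ π₀) (hκ.isUCP H₂ ρ₀) ht ζ

end Restriction

section SG

variable {V W : Type} {G : Scenario V} {K : Scenario W}

theorem IsCStarPOR.isCStarUCP_lift {A : Type} [CStarAlgebra A] {a : V → A} (ha : IsCStarPOR G a)
    (hker : G.kernel ≤ LinearMap.ker (G.pairing a)) : G.sgOrder.IsCStarUCP (G.lift a hker) where
  map_one := G.pairing_one ha.2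
  isUCP H _ _ _ π := by
    have hmap : π.toAlgHom.toLinearMap ∘ₗ G.lift a hker = (ha.map π).map := by
      refine LinearMap.ext_on_range G.span_range_gen fun x => ?_
      rw [IsPOR.map_gen, LinearMap.comp_apply, G.lift_gen]
      rfl
    rw [hmap]
    exact IsPOR.isUCP_map _

variable (G) in
/-- The canonical map `S_G → B_G`, `a_x ↦ g_{x,x}`. -/
def Scenario.toBG : G.SG →ₗ[ℂ] G.BG := G.lift G.bgen (kernel_le_of_evalGen fun θ => θ.isPOR)

theorem Scenario.toBG_gen (x : V) : G.toBG (G.gen x) = G.bgen x := G.lift_gen _ _ x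

theorem isCStarUCP_toBG (G : Scenario V) : G.sgOrder.IsCStarUCP G.toBG :=
  (isCStarPOR_bgen G).isCStarUCP_lift _

section Values

variable {A B : Type} [CStarAlgebra A] [CStarAlgebra B] {ι : G.SG →ₗ[ℂ] A} {κ : K.SG →ₗ[ℂ] B}
  {a : V → A} {b : W → B}

theorem pState_comp_ofTensor {𝓕 : CommRep A B → Prop} (ha : ∀ x, ι (G.gen x) = a x)
    (hb : ∀ y, κ (K.gen y) = b y) (s : tensorCompletion A B 𝓕 →ₗ[ℂ] ℂ) :
    pState G K (s ∘ₗ tensorCompletion.ofTensor A B 𝓕 ∘ₗ TensorProduct.map ι κ) =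
      fun z => s (tensorCompletion.tmul 𝓕 (a z.1) (b z.2)) :=
  funext fun z => congrArg₂ (fun c d => s (tensorCompletion.tmul 𝓕 c d)) (ha z.1) (hb z.2)

theorem MatrixOrder.IsCStarUCP.exists_commTensor_state (hι : G.sgOrder.IsCStarUCP ι)
    (hκ : K.sgOrder.IsCStarUCP κ) (ha : ∀ x, ι (G.gen x) = a x) (hb : ∀ y, κ (K.gen y) = b y)
    {s : MaxTensor A B →ₗ[ℂ] ℂ} (hs : s ∈ cstarStates (MaxTensor A B)) :
    ∃ s' ∈ (G.sgOrder.commTensor K.sgOrder).states,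
      pState G K s' = fun z => s (tensorCompletion.tmul _ (a z.1) (b z.2)) :=
  ⟨_, comp_ofTensor_mem_states_commTensor hι hκ hs, pState_comp_ofTensor ha hb s⟩

theorem MatrixOrder.IsCStarUCP.exists_minTensor_state (hι : G.sgOrder.IsCStarUCP ι)
    (hκ : K.sgOrder.IsCStarUCP κ) (ha : ∀ x, ι (G.gen x) = a x) (hb : ∀ y, κ (K.gen y) = b y)
    {s : MinTensor A B →ₗ[ℂ] ℂ} (hs : s ∈ cstarStates (MinTensor A B)) :
    ∃ s' ∈ (G.sgOrder.minTensor K.sgOrder).states,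
      pState G K s' = fun z => s (tensorCompletion.tmul _ (a z.1) (b z.2)) :=
  ⟨_, comp_ofTensor_mem_states_minTensor hι hκ hs, pState_comp_ofTensor ha hb s⟩

end Values

variable {f : V × W → ℂ}

theorem exists_commTensor_state_of_cstarMaxTensor_state
    (hf : ∃ s ∈ cstarStates (MaxTensor G.BG K.BG), f = pStateB G K s) :
    ∃ s ∈ (G.sgOrder.commTensor K.sgOrder).states, f = pState G K s := by
  obtain ⟨s, hs, rfl⟩ := hf
  have hstate := (isCStarUCP_toBG G).exists_commTensor_state (isCStarUCP_toBG K) G.toBG_gen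
    K.toBG_gen hs
  obtain ⟨t, ht, hts⟩ := hstate
  exact ⟨t, ht, hts.symm⟩

theorem exists_minTensor_state_of_cstarMinTensor_state
    (hf : ∃ s ∈ cstarStates (MinTensor G.BG K.BG), f = pStateB G K s) :
    ∃ s ∈ (G.sgOrder.minTensor K.sgOrder).states, f = pState G K s := by
  obtain ⟨s, hs, rfl⟩ := hf
  have hstate := (isCStarUCP_toBG G).exists_minTensor_state (isCStarUCP_toBG K) G.toBG_gen
    K.toBG_gen hs
  obtain ⟨t, ht, hts⟩ := hstate
  exact ⟨t, ht, hts.symm⟩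

end SG

/-! ### Tensor product models -/

section TensorOperators

variable (E F : Type) [NormedAddCommGroup E] [InnerProductSpace ℂ E] [NormedAddCommGroup F]
  [InnerProductSpace ℂ F] [CompleteSpace E] [CompleteSpace F] [CompleteSpace (E ⊗[ℂ] F)]

/-- The representation `T ↦ T ⊗ 1` of `B(E)` on `E ⊗ F`. -/
def tensorLeft : (E →L[ℂ] E) →⋆ₐ[ℂ] (E ⊗[ℂ] F →L[ℂ] E ⊗[ℂ] F) where
  toFun T := TensorProduct.mapL T 1
  map_one' := TensorProduct.mapL_id_id
  map_mul' S T := by rw [← TensorProduct.mapL_mul, one_mul]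
  map_zero' := TensorProduct.mapL_zero_left 1
  map_add' S T := TensorProduct.mapL_add_left S T 1
  commutes' c := by
    rw [Algebra.algebraMap_eq_smul_one, Algebra.algebraMap_eq_smul_one,
      TensorProduct.mapL_smul_left]
    exact congrArg _ TensorProduct.mapL_id_id
  map_star' T := by
    simp only [ContinuousLinearMap.star_eq_adjoint, TensorProduct.adjoint_mapL,
      ← ContinuousLinearMap.star_eq_adjoint 1, star_one]

/-- The representation `T ↦ 1 ⊗ T` of `B(F)` on `E ⊗ F`. -/
def tensorRight : (F →L[ℂ] F) →⋆ₐ[ℂ] (E ⊗[ℂ] F →L[ℂ] E ⊗[ℂ] F) where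
  toFun T := TensorProduct.mapL 1 T
  map_one' := TensorProduct.mapL_id_id
  map_mul' S T := by rw [← TensorProduct.mapL_mul, one_mul]
  map_zero' := TensorProduct.mapL_zero_right 1
  map_add' S T := TensorProduct.mapL_add_right 1 S T
  commutes' c := by
    rw [Algebra.algebraMap_eq_smul_one, Algebra.algebraMap_eq_smul_one,
      TensorProduct.mapL_smul_right]
    exact congrArg _ TensorProduct.mapL_id_id
  map_star' T := by
    simp only [ContinuousLinearMap.star_eq_adjoint, TensorProduct.adjoint_mapL,
      ← ContinuousLinearMap.star_eq_adjoint 1, star_one]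

variable {E F} (S : E →L[ℂ] E) (T : F →L[ℂ] F)

theorem tensorLeft_mul_tensorRight :
    tensorLeft E F S * tensorRight E F T = TensorProduct.mapL S T := by
  change TensorProduct.mapL S 1 * TensorProduct.mapL 1 T = _
  rw [← TensorProduct.mapL_mul, mul_one, one_mul]

theorem tensorRight_mul_tensorLeft :
    tensorRight E F T * tensorLeft E F S = TensorProduct.mapL S T := by
  change TensorProduct.mapL 1 T * TensorProduct.mapL S 1 = _
  rw [← TensorProduct.mapL_mul, mul_one, one_mul]

end TensorOperators

section TensorModels

variable {V W : Type} {G : Scenario V} {K : Scenario W} {E F : Type} [NormedAddCommGroup E]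
  [InnerProductSpace ℂ E] [NormedAddCommGroup F] [InnerProductSpace ℂ F]
  {A : V → E →L[ℂ] E} {B : W → F →L[ℂ] F}

theorem IsPOR.isCStarPOR [CompleteSpace E] (hA : IsPOR G A) : IsCStarPOR G A :=
  ⟨fun x => CStarAlgebra.nonneg_iff_eq_star_mul_self.1
    ((ContinuousLinearMap.nonneg_iff_isPositive _).2 (hA.1 x)), hA.2⟩

theorem IsPOR.isCommutingPOR_tensor [CompleteSpace E] [CompleteSpace F] [CompleteSpace (E ⊗[ℂ] F)]
    (hA : IsPOR G A) (hB : IsPOR K B) :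
    IsCommutingPOR G K (fun x => tensorLeft E F (A x)) fun y => tensorRight E F (B y) where
  left := hA.isCStarPOR.map (tensorLeft E F)
  right := hB.isCStarPOR.map (tensorRight E F)
  comm x y := by rw [tensorLeft_mul_tensorRight, tensorRight_mul_tensorLeft]

theorem IsPOR.exists_mem_genQ [FiniteDimensional ℂ E] [FiniteDimensional ℂ F] (hA : IsPOR G A)
    (hB : IsPOR K B) {ξ : E ⊗[ℂ] F} (hξ : ‖ξ‖ = 1) :
    ∃ p ∈ genQ G K, ∀ x y, (p (x, y) : ℂ) = inner ℂ ξ (TensorProduct.mapL (A x) (B y) ξ) := by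
  have := FiniteDimensional.complete ℂ E
  have := FiniteDimensional.complete ℂ F
  have := FiniteDimensional.complete ℂ (E ⊗[ℂ] F)
  obtain ⟨p, hp, hval⟩ := (hA.isCommutingPOR_tensor hB).exists_mem_noSignalling hξ
  exact ⟨p, ⟨hp, E, inferInstance, inferInstance, F, inferInstance, inferInstance, A, B, ξ,
    inferInstance, inferInstance, hA, hB, hξ, hval⟩,
    fun x y => by rw [hval, tensorLeft_mul_tensorRight]⟩

theorem exists_realisation_of_mem_genQ {p : V × W → ℝ} (hp : p ∈ genQ G K) :
    ∃ (E : Type) (_ : NormedAddCommGroup E) (_ : InnerProductSpace ℂ E)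
      (F : Type) (_ : NormedAddCommGroup F) (_ : InnerProductSpace ℂ F)
      (_ : FiniteDimensional ℂ E) (_ : FiniteDimensional ℂ F)
      (A : V → E →L[ℂ] E) (B : W → F →L[ℂ] F) (ξ : E ⊗[ℂ] F),
      IsPOR G A ∧ IsPOR K B ∧ ‖ξ‖ = 1 ∧
      ∀ x y, (p (x, y) : ℂ) = inner ℂ ξ (TensorProduct.mapL (A x) (B y) ξ) := by
  obtain ⟨-, E, _, _, F, _, _, A, B, ξ, hE, hF, hA, hB, hξ, hval⟩ := hp
  exact ⟨E, _, _, F, _, _, hE, hF, A, B, ξ, hA, hB, hξ, fun x y => by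
    rw [hval, ← TensorProduct.mapL_mul, mul_one, one_mul]⟩

end TensorModels

/-! ### Convexity of the set of approximately quantum models -/

section DirectSum

variable (E F : Type) [NormedAddCommGroup E] [InnerProductSpace ℂ E] [NormedAddCommGroup F]
  [InnerProductSpace ℂ F]

/-- The inclusion of the first summand of `E ⊕ F`. -/
def sumInl : E →ₗᵢ[ℂ] WithLp 2 (E × F) where
  toLinearMap := (WithLp.linearEquiv 2 ℂ (E × F)).symm.toLinearMap ∘ₗ LinearMap.inl ℂ E F
  norm_map' := WithLp.norm_toLp_fst 2 E F

/-- The inclusion of the second summand of `E ⊕ F`. -/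
def sumInr : F →ₗᵢ[ℂ] WithLp 2 (E × F) where
  toLinearMap := (WithLp.linearEquiv 2 ℂ (E × F)).symm.toLinearMap ∘ₗ LinearMap.inr ℂ E F
  norm_map' := WithLp.norm_toLp_snd 2 E F

variable {E F}

/-- The direct sum `S ⊕ T` on the Hilbert space `E ⊕ F`. -/
def sumOp (S : E →L[ℂ] E) (T : F →L[ℂ] F) : WithLp 2 (E × F) →L[ℂ] WithLp 2 (E × F) :=
  (WithLp.prodContinuousLinearEquiv 2 ℂ E F).symm.toContinuousLinearMap ∘L S.prodMap T ∘L
    (WithLp.prodContinuousLinearEquiv 2 ℂ E F).toContinuousLinearMap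

variable (S : E →L[ℂ] E) (T : F →L[ℂ] F)

theorem sumOp_comp_sumInl : sumOp S T ∘L (sumInl E F).toContinuousLinearMap =
    (sumInl E F).toContinuousLinearMap ∘L S := by
  ext ξ : 1
  change WithLp.toLp 2 (S ξ, T 0) = WithLp.toLp 2 (S ξ, 0)
  rw [map_zero]

theorem sumOp_comp_sumInr : sumOp S T ∘L (sumInr E F).toContinuousLinearMap =
    (sumInr E F).toContinuousLinearMap ∘L T := by
  ext ξ : 1
  change WithLp.toLp 2 (S 0, T ξ) = WithLp.toLp 2 (0, T ξ)
  rw [map_zero]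

theorem inner_sumInl_sumInr (ξ : E) (η : F) : inner ℂ (sumInl E F ξ) (sumInr E F η) = 0 := by
  rw [WithLp.prod_inner_apply]
  change inner ℂ ξ (0 : E) + inner ℂ (0 : F) η = 0
  rw [inner_zero_right, inner_zero_left, add_zero]

theorem inner_sumOp (ζ : WithLp 2 (E × F)) :
    inner ℂ ζ (sumOp S T ζ) = inner ℂ ζ.fst (S ζ.fst) + inner ℂ ζ.snd (T ζ.snd) := by
  rw [WithLp.prod_inner_apply]
  rfl

theorem IsPOR.sumOp {V : Type} {G : Scenario V} {A : V → E →L[ℂ] E} {B : V → F →L[ℂ] F}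
    (hA : IsPOR G A) (hB : IsPOR G B) : IsPOR G fun x => sumOp (A x) (B x) := by
  refine ⟨fun x => isPositive_of_inner_nonneg fun ζ => ?_, fun e he => ?_⟩
  · rw [inner_sumOp]
    exact add_nonneg ((hA.1 x).inner_nonneg_right _) ((hB.1 x).inner_nonneg_right _)
  · ext ζ : 1
    refine WithLp.ofLp_injective 2 (Prod.ext ?_ ?_)
    · simpa [Contextuality.sumOp, Prod.fst_sum] using
        congrArg (fun R : E →L[ℂ] E => R ζ.fst) (hA.2 e he)
    · simpa [Contextuality.sumOp, Prod.snd_sum] using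
        congrArg (fun R : F →L[ℂ] F => R ζ.snd) (hB.2 e he)

end DirectSum

section Convexity

section Intertwining

variable {E₁ E₂ F₁ F₂ : Type} [NormedAddCommGroup E₁] [InnerProductSpace ℂ E₁]
  [NormedAddCommGroup E₂] [InnerProductSpace ℂ E₂] [NormedAddCommGroup F₁] [InnerProductSpace ℂ F₁]
  [NormedAddCommGroup F₂] [InnerProductSpace ℂ F₂] (S₁ : E₁ →L[ℂ] E₁) (S₂ : E₂ →L[ℂ] E₂)
  (T₁ : F₁ →L[ℂ] F₁) (T₂ : F₂ →L[ℂ] F₂)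

theorem mapL_sumOp_mapIsometry_sumInl (ζ : E₁ ⊗[ℂ] F₁) :
    TensorProduct.mapL (sumOp S₁ S₂) (sumOp T₁ T₂)
        (TensorProduct.mapIsometry (sumInl E₁ E₂) (sumInl F₁ F₂) ζ) =
      TensorProduct.mapIsometry (sumInl E₁ E₂) (sumInl F₁ F₂) (TensorProduct.mapL S₁ T₁ ζ) := by
  simp only [← LinearIsometry.coe_toContinuousLinearMap,
    TensorProduct.toContinuousLinearMap_mapIsometry, ← ContinuousLinearMap.comp_apply,
    ← TensorProduct.mapL_comp, sumOp_comp_sumInl]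

theorem mapL_sumOp_mapIsometry_sumInr (ζ : E₂ ⊗[ℂ] F₂) :
    TensorProduct.mapL (sumOp S₁ S₂) (sumOp T₁ T₂)
        (TensorProduct.mapIsometry (sumInr E₁ E₂) (sumInr F₁ F₂) ζ) =
      TensorProduct.mapIsometry (sumInr E₁ E₂) (sumInr F₁ F₂) (TensorProduct.mapL S₂ T₂ ζ) := by
  simp only [← LinearIsometry.coe_toContinuousLinearMap,
    TensorProduct.toContinuousLinearMap_mapIsometry, ← ContinuousLinearMap.comp_apply,
    ← TensorProduct.mapL_comp, sumOp_comp_sumInr]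

end Intertwining

theorem inner_mapIsometry_mapIsometry_eq_zero {E E₁ E₂ F F₁ F₂ : Type} [NormedAddCommGroup E]
    [InnerProductSpace ℂ E] [NormedAddCommGroup E₁] [InnerProductSpace ℂ E₁]
    [NormedAddCommGroup E₂] [InnerProductSpace ℂ E₂] [NormedAddCommGroup F] [InnerProductSpace ℂ F]
    [NormedAddCommGroup F₁] [InnerProductSpace ℂ F₁] [NormedAddCommGroup F₂]
    [InnerProductSpace ℂ F₂] {v₁ : E₁ →ₗᵢ[ℂ] E} {v₂ : E₂ →ₗᵢ[ℂ] E}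
    (hv : ∀ ξ η, inner ℂ (v₁ ξ) (v₂ η) = 0) (w₁ : F₁ →ₗᵢ[ℂ] F) (w₂ : F₂ →ₗᵢ[ℂ] F)
    (ζ₁ : E₁ ⊗[ℂ] F₁) (ζ₂ : E₂ ⊗[ℂ] F₂) :
    inner ℂ (TensorProduct.mapIsometry v₁ w₁ ζ₁) (TensorProduct.mapIsometry v₂ w₂ ζ₂) = 0 := by
  induction ζ₁ with
  | zero => rw [map_zero, inner_zero_left]
  | add ζ ζ' h h' => rw [map_add, inner_add_left, h, h', add_zero]
  | tmul ξ₁ η₁ =>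
    induction ζ₂ with
    | zero => rw [map_zero, inner_zero_right]
    | add ζ ζ' h h' => rw [map_add, inner_add_right, h, h', add_zero]
    | tmul ξ₂ η₂ =>
      change inner ℂ (v₁ ξ₁ ⊗ₜ[ℂ] w₁ η₁) (v₂ ξ₂ ⊗ₜ[ℂ] w₂ η₂) = 0
      rw [TensorProduct.inner_tmul, hv, zero_mul]

theorem exists_unit_inner_eq_convex_combination {X X₁ X₂ : Type} [NormedAddCommGroup X]
    [InnerProductSpace ℂ X] [NormedAddCommGroup X₁] [InnerProductSpace ℂ X₁]
    [NormedAddCommGroup X₂] [InnerProductSpace ℂ X₂] {J₁ : X₁ →ₗᵢ[ℂ] X} {J₂ : X₂ →ₗᵢ[ℂ] X}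
    (horth : ∀ ξ η, inner ℂ (J₁ ξ) (J₂ η) = 0) {α β : ℝ} (hα : 0 ≤ α) (hβ : 0 ≤ β)
    (hαβ : α + β = 1) {ξ₁ : X₁} {ξ₂ : X₂} (hξ₁ : ‖ξ₁‖ = 1) (hξ₂ : ‖ξ₂‖ = 1) :
    ∃ ζ : X, ‖ζ‖ = 1 ∧ ∀ (T : X →L[ℂ] X) (T₁ : X₁ →L[ℂ] X₁) (T₂ : X₂ →L[ℂ] X₂),
      (∀ ξ, T (J₁ ξ) = J₁ (T₁ ξ)) → (∀ ξ, T (J₂ ξ) = J₂ (T₂ ξ)) →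
      inner ℂ ζ (T ζ) = α * inner ℂ ξ₁ (T₁ ξ₁) + β * inner ℂ ξ₂ (T₂ ξ₂) := by
  let ζ : X := (Real.sqrt α : ℂ) • J₁ ξ₁ + (Real.sqrt β : ℂ) • J₂ ξ₂
  have horth' : ∀ ξ η, inner ℂ (J₂ η) (J₁ ξ) = 0 := fun ξ η => inner_eq_zero_symm.1 (horth ξ η)
  have hsq : ∀ {r : ℝ}, 0 ≤ r → (Real.sqrt r : ℂ) * Real.sqrt r = r := fun hr => by
    rw [← Complex.ofReal_mul, Real.mul_self_sqrt hr]
  have hval : ∀ (T : X →L[ℂ] X) (T₁ : X₁ →L[ℂ] X₁) (T₂ : X₂ →L[ℂ] X₂),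
      (∀ ξ, T (J₁ ξ) = J₁ (T₁ ξ)) → (∀ ξ, T (J₂ ξ) = J₂ (T₂ ξ)) →
      inner ℂ ζ (T ζ) = α * inner ℂ ξ₁ (T₁ ξ₁) + β * inner ℂ ξ₂ (T₂ ξ₂) := fun T T₁ T₂ h₁ h₂ => by
    simp only [ζ, map_add, map_smul, h₁, h₂, inner_add_left, inner_add_right, inner_smul_left,
      inner_smul_right, Complex.conj_ofReal, LinearIsometry.inner_map_map, horth, horth', mul_zero,
      add_zero, zero_add, ← mul_assoc, hsq hα, hsq hβ]
  refine ⟨ζ, ?_, hval⟩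
  have hone := hval 1 1 1 (fun _ => rfl) fun _ => rfl
  simp only [one_apply_eq_self, inner_self_eq_norm_sq_to_K, hξ₁, hξ₂] at hone
  have hnorm : ((‖ζ‖ ^ 2 : ℝ) : ℂ) = (α + β : ℝ) := by simpa using hone
  rwa [Complex.ofReal_inj, hαβ, pow_eq_one_iff_of_nonneg (norm_nonneg ζ) two_ne_zero] at hnorm

variable {V W : Type}

theorem convex_genQ (G : Scenario V) (K : Scenario W) : Convex ℝ (genQ G K) := by
  intro p hp q hq α β hα hβ hαβ
  obtain ⟨E₁, _, _, F₁, _, _, _, _, A₁, B₁, ξ₁, hA₁, hB₁, hξ₁, hval₁⟩ :=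
    exists_realisation_of_mem_genQ hp
  obtain ⟨E₂, _, _, F₂, _, _, _, _, A₂, B₂, ξ₂, hA₂, hB₂, hξ₂, hval₂⟩ :=
    exists_realisation_of_mem_genQ hq
  obtain ⟨ζ, hζ, hvalζ⟩ := exists_unit_inner_eq_convex_combination
    (inner_mapIsometry_mapIsometry_eq_zero (inner_sumInl_sumInr (E := E₁) (F := E₂))
      (sumInl F₁ F₂) (sumInr F₁ F₂)) hα hβ hαβ hξ₁ hξ₂
  obtain ⟨r, hr, hvalr⟩ := (hA₁.sumOp hA₂).exists_mem_genQ (hB₁.sumOp hB₂) hζ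
  convert hr
  refine funext fun z => Complex.ofReal_injective ?_
  rw [hvalr z.1 z.2, hvalζ _ (TensorProduct.mapL (A₁ z.1) (B₁ z.2))
    (TensorProduct.mapL (A₂ z.1) (B₂ z.2)) (mapL_sumOp_mapIsometry_sumInl _ _ _ _)
    (mapL_sumOp_mapIsometry_sumInr _ _ _ _), ← hval₁, ← hval₂]
  simp

theorem convex_genQA (G : Scenario V) (K : Scenario W) : Convex ℝ (genQA G K) :=
  (convex_genQ G K).closure

theorem nonneg_of_mem_genQA {G : Scenario V} {K : Scenario W} {p : V × W → ℝ} (hp : p ∈ genQA G K)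
    (z : V × W) : 0 ≤ p z :=
  closure_minimal (t := {p : V × W → ℝ | 0 ≤ p z}) (fun _ hq => (hq.1.1.1 z).1)
    (isClosed_le continuous_const (continuous_apply z)) hp

theorem exists_mem_genQA_of_mem_states [Finite V] [Finite W] {G : Scenario V}
    {K : Scenario W} {s : G.SG ⊗[ℂ] K.SG →ₗ[ℂ] ℂ}
    (hs : s ∈ (G.sgOrder.minTensor K.sgOrder).states) :
    ∃ p ∈ genQA G K, toComplex p = pState G K s := by
  suffices h : ∃ p ∈ genQA G K, ∀ z : V × W, (p z : ℂ) = s (G.gen z.1 ⊗ₜ K.gen z.2) from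
    h.imp fun p hp => ⟨hp.1, funext hp.2⟩
  refine exists_mem_of_mem_states (convex_genQA G K) isClosed_closure
    (fun p hp z => nonneg_of_mem_genQA hp z) (fun a ha => ?_) hs
  intro k l φ ψ hφ hψ
  refine isPositiveOpMatrix_one_of_isPositive (isPositive_of_forall_unit fun ξ hξ => ?_)
  refine ha (vectorFunctional ξ ∘ₗ opTensor φ ψ) ?_ ?_
  · change inner ℂ ξ (TensorProduct.mapL (φ G.sgOrder.one) (ψ K.sgOrder.one) ξ) = 1
    rw [hφ.1, hψ.1, ContinuousLinearMap.one_def, ContinuousLinearMap.one_def,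
      TensorProduct.mapL_id_id, ContinuousLinearMap.id_apply]
    exact inner_self_eq_one_of_norm_eq_one hξ
  · obtain ⟨p, hp, hval⟩ := hφ.isPOR.exists_mem_genQ hψ.isPOR hξ
    exact ⟨p, subset_closure hp, fun z => hval z.1 z.2⟩

end Convexity

/-! ### States of the minimal C*-algebraic tensor product -/

section VectorStates

variable {A B : Type} [CStarAlgebra A] [CStarAlgebra B] {E F : Type} [NormedAddCommGroup E]
  [InnerProductSpace ℂ E] [NormedAddCommGroup F] [InnerProductSpace ℂ F] [CompleteSpace E]
  [CompleteSpace F] [CompleteSpace (E ⊗[ℂ] F)]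

/-- The commuting pair `π ⊗ 1`, `1 ⊗ ρ` of representations on `E ⊗ F`. -/
def CommRep.tensor [Nontrivial (E ⊗[ℂ] F)] (π : A →⋆ₐ[ℂ] (E →L[ℂ] E))
    (ρ : B →⋆ₐ[ℂ] (F →L[ℂ] F)) : CommRep A B where
  H := E ⊗[ℂ] F
  π := (tensorLeft E F).comp π
  ρ := (tensorRight E F).comp ρ
  comm a b := by
    rw [StarAlgHom.comp_apply, StarAlgHom.comp_apply, tensorLeft_mul_tensorRight,
      tensorRight_mul_tensorLeft]

theorem CommRep.isSpatial_tensor [Nontrivial (E ⊗[ℂ] F)] (π : A →⋆ₐ[ℂ] (E →L[ℂ] E))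
    (ρ : B →⋆ₐ[ℂ] (F →L[ℂ] F)) : (CommRep.tensor π ρ).IsSpatial :=
  ⟨E, inferInstance, inferInstance, inferInstance, F, inferInstance, inferInstance, inferInstance,
    π, ρ, LinearIsometry.id, Function.surjective_id.denseRange, fun _ _ _ => rfl, fun _ _ _ => rfl⟩

theorem exists_minTensor_state_tmul_eq_inner (π : A →⋆ₐ[ℂ] (E →L[ℂ] E))
    (ρ : B →⋆ₐ[ℂ] (F →L[ℂ] F)) {ξ : E ⊗[ℂ] F} (hξ : ‖ξ‖ = 1) :
    ∃ s ∈ cstarStates (MinTensor A B), ∀ a b,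
      s (tensorCompletion.tmul _ a b) = inner ℂ ξ (TensorProduct.mapL (π a) (ρ b) ξ) := by
  have : Nontrivial (E ⊗[ℂ] F) := ⟨⟨ξ, 0, fun h => by simp [h] at hξ⟩⟩
  obtain ⟨s, hs, hval⟩ := exists_state_tmul_eq_inner _ (CommRep.isSpatial_tensor π ρ) (ξ := ξ) hξ
  refine ⟨s, hs, fun a b => ?_⟩
  rw [hval, ← tensorLeft_mul_tensorRight]
  rfl

theorem exists_minTensor_cstarGen_state_tmul_eq_inner {X : Set A} {Y : Set B}
    (π : A →⋆ₐ[ℂ] (E →L[ℂ] E)) (ρ : B →⋆ₐ[ℂ] (F →L[ℂ] F)) {ξ : E ⊗[ℂ] F} (hξ : ‖ξ‖ = 1) :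
    ∃ s ∈ cstarStates (MinTensor (cstarGen X) (cstarGen Y)), ∀ a b,
      s (tensorCompletion.tmul _ a b) = inner ℂ ξ (TensorProduct.mapL (π a) (ρ b) ξ) :=
  exists_minTensor_state_tmul_eq_inner (π.comp (cstarGen X).subtype) (ρ.comp (cstarGen Y).subtype)
    hξ

end VectorStates

section MinStates

variable {V W : Type} {G : Scenario V} {K : Scenario W} {p : V × W → ℝ}

theorem exists_cstarMinTensor_state_of_mem_genQ (hp : p ∈ genQ G K) :
    ∃ s ∈ cstarStates (MinTensor G.BG K.BG), toComplex p = pStateB G K s := by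
  have hreal := exists_realisation_of_mem_genQ hp
  obtain ⟨E, _, _, F, _, _, _, _, A, B, ξ, hA, hB, hξ, hval⟩ := hreal
  have := FiniteDimensional.complete ℂ E
  have := FiniteDimensional.complete ℂ F
  have := FiniteDimensional.complete ℂ (E ⊗[ℂ] F)
  have := FiniteDimensional.proper ℂ E
  have := FiniteDimensional.proper ℂ F
  have hξ0 : ξ ≠ 0 := fun h => by simp [h] at hξ
  have : Nontrivial E := not_subsingleton_iff_nontrivial.1 fun _ => hξ0 (Subsingleton.elim _ _)
  have : Nontrivial F := not_subsingleton_iff_nontrivial.1 fun _ => hξ0 (Subsingleton.elim _ _)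
  have hπ := hA.exists_starAlgHom_g_eq
  have hρ := hB.exists_starAlgHom_g_eq
  obtain ⟨π, hπ⟩ := hπ
  obtain ⟨ρ, hρ⟩ := hρ
  have hstate := exists_minTensor_cstarGen_state_tmul_eq_inner
    (X := Set.range fun x => G.g x x) (Y := Set.range fun y => K.g y y) π ρ hξ
  obtain ⟨s, hs, hsval⟩ := hstate
  refine ⟨s, hs, funext fun z => Eq.trans ?_ (hsval (G.bgen z.1) (K.bgen z.2)).symm⟩
  change (p z : ℂ) = inner ℂ ξ (TensorProduct.mapL (π (G.g z.1 z.1)) (ρ (K.g z.2 z.2)) ξ)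
  rw [hπ, hρ, hval]

theorem isClosed_image_cstarStates_tensorCompletion {A B : Type} [CStarAlgebra A] [CStarAlgebra B]
    (𝓕 : CommRep A B → Prop) (a : V → A) (b : W → B) :
    IsClosed ((fun (s : tensorCompletion A B 𝓕 →ₗ[ℂ] ℂ) (z : V × W) =>
      s (tensorCompletion.tmul 𝓕 (a z.1) (b z.2))) '' cstarStates (tensorCompletion A B 𝓕)) :=
  isClosed_stateValues fun z : V × W => tensorCompletion.tmul 𝓕 (a z.1) (b z.2)

theorem isClosed_image_pStateB_minTensor (G : Scenario V) (K : Scenario W) :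
    IsClosed (pStateB G K '' cstarStates (MinTensor G.BG K.BG)) :=
  isClosed_image_cstarStates_tensorCompletion CommRep.IsSpatial G.bgen K.bgen

theorem exists_cstarMinTensor_state_of_mem_genQA (hp : p ∈ genQA G K) :
    ∃ s ∈ cstarStates (MinTensor G.BG K.BG), toComplex p = pStateB G K s := by
  have hmem : toComplex p ∈ pStateB G K '' cstarStates (MinTensor G.BG K.BG) :=
    closure_minimal (fun q hq => (exists_cstarMinTensor_state_of_mem_genQ hq).imp
      fun s hs => ⟨hs.1, hs.2.symm⟩)
      ((isClosed_image_pStateB_minTensor G K).preimage continuous_toComplex) hp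
  exact hmem.imp fun s hs => ⟨hs.1, hs.2.symm⟩

end MinStates

/-! ### The affine isomorphisms -/

section AffineIso

theorem convex_states {S : Type} [AddCommGroup S] [Module ℂ S] (O : MatrixOrder S) :
    Convex ℝ O.states := by
  intro s hs t ht α β hα hβ hαβ
  refine ⟨?_, fun a ha => ?_⟩
  · simp [hs.1, ht.1, ← Complex.ofReal_add, hαβ]
  · exact add_nonneg (smul_nonneg hα (hs.2 a ha)) (smul_nonneg hβ (ht.2 a ha))

variable {V W : Type}

theorem pState_injective (G : Scenario V) (K : Scenario W) : Function.Injective (pState G K) :=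
  fun _ _ h => tensor_ext fun x y => congrFun h (x, y)

theorem isAffineIso_pState {G : Scenario V} {K : Scenario W} {O : MatrixOrder (G.SG ⊗[ℂ] K.SG)}
    {C : Set (V × W → ℝ)} (hC : Convex ℝ C)
    (hmaps : ∀ s ∈ O.states, ∃ p ∈ C, toComplex p = pState G K s)
    (hsurj : ∀ p ∈ C, ∃ s ∈ O.states, toComplex p = pState G K s) :
    IsAffineIso (pState G K) O.states (toComplex '' C) :=
  ⟨convex_states O, hC.is_linear_image isLinearMap_toComplex,
    ⟨hmaps, (pState_injective G K).injOn, Set.forall_mem_image.2 fun p hp =>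
      (hsurj p hp).imp fun _ hs => ⟨hs.1, hs.2.symm⟩⟩, fun _ _ _ _ _ _ => rfl⟩

theorem mem_iff_exists_pState_eq {G : Scenario V} {K : Scenario W}
    {O : MatrixOrder (G.SG ⊗[ℂ] K.SG)} {C : Set (V × W → ℝ)}
    (hiso : IsAffineIso (pState G K) O.states (toComplex '' C)) {p : V × W → ℝ} :
    p ∈ C ↔ ∃ s ∈ O.states, toComplex p = pState G K s := by
  rw [← toComplex_injective.mem_set_image, ← hiso.2.2.1.image_eq]
  exact exists_congr fun s => and_congr_right fun _ => eq_comm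

variable [Finite V] [Finite W] (G : Scenario V) (K : Scenario W)

theorem isAffineIso_pState_commTensor :
    IsAffineIso (pState G K) (G.sgOrder.commTensor K.sgOrder).states (toComplex '' genQC G K) :=
  isAffineIso_pState (convex_genQC G K) (fun _ hs => exists_mem_genQC_of_mem_states hs)
    fun _ hp => exists_commTensor_state_of_cstarMaxTensor_state
      (exists_cstarMaxTensor_state_of_mem_genQC hp)

theorem isAffineIso_pState_minTensor :
    IsAffineIso (pState G K) (G.sgOrder.minTensor K.sgOrder).states (toComplex '' genQA G K) :=
  isAffineIso_pState (convex_genQA G K) (fun _ hs => exists_mem_genQA_of_mem_states hs)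
    fun _ hp => exists_minTensor_state_of_cstarMinTensor_state
      (exists_cstarMinTensor_state_of_mem_genQA hp)

end AffineIso

end Contextuality

end

open Contextuality in
theorem mainTheorem3 {V W : Type} [Fintype V] [Fintype W] (G : Scenario V) (K : Scenario W)
    (hG : G.IsNontrivial) (hK : K.IsNontrivial) :
    (∀ p ∈ (G.prod K).models,
      [p ∈ genQC G K,
        ∃ s ∈ (G.sgOrder.commTensor K.sgOrder).states, toComplex p = pState G K s,
        ∃ s ∈ cstarStates (MaxTensor G.BG K.BG), toComplex p = pStateB G K s].TFAE) ∧
    (∀ p ∈ (G.prod K).models,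
      [p ∈ genQA G K,
        ∃ s ∈ (G.sgOrder.minTensor K.sgOrder).states, toComplex p = pState G K s,
        ∃ s ∈ cstarStates (MinTensor G.BG K.BG), toComplex p = pStateB G K s].TFAE) ∧
    IsAffineIso (pState G K) (G.sgOrder.commTensor K.sgOrder).states (toComplex '' genQC G K) ∧
    IsAffineIso (pState G K) (G.sgOrder.minTensor K.sgOrder).states (toComplex '' genQA G K) := by
  have hQC := isAffineIso_pState_commTensor G K
  have hQA := isAffineIso_pState_minTensor G K
  refine ⟨fun p _ => ?_, fun p _ => ?_, hQC, hQA⟩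
  · tfae_have 2 → 1 := (mem_iff_exists_pState_eq hQC).2
    tfae_have 1 → 3 := exists_cstarMaxTensor_state_of_mem_genQC
    tfae_have 3 → 2 := exists_commTensor_state_of_cstarMaxTensor_state
    tfae_finish
  · tfae_have 2 → 1 := (mem_iff_exists_pState_eq hQA).2
    tfae_have 1 → 3 := exists_cstarMinTensor_state_of_mem_genQA
    tfae_have 3 → 2 := exists_minTensor_state_of_cstarMinTensor_state
    tfae_finish
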